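/- Let $X$ be a real reflexive Banach space, $P\subset X$ a closed convex cone ($\lambda x\in P$ for $x\in P,\ \lambda\ge 0$) with $P\cap(-P)=\{0\}$, and $J:X\to\mathbb R$ locally Lipschitz. Write $$J^0(x;h)=\limsup_{x'\to x,\ \lambda\downarrow 0}\frac{J(x'+\lambda h)-J(x')}{\lambda},\qquad \partial J(x)=\{x^*\in X^*:\langle x^*,h\rangle\le J^0(x;h)\ \ \forall h\in X\},$$ $\mathscr F(x^*)=\{y\in X:\langle x^*,y\rangle=\|x^*\|^2=\|y\|^2\}$ and $\nabla J(x)=\bigcup_{x^*\in\partial J(x)}\mathscr F(x^*)$. For $D\subset X$ and $x\in D$ put $$m_D(x)=\inf_{x^*\in\partial J(x)}\ \sup\{\langle x^*,x-y\rangle: y\in D,\ \|x-y\|<1\},\qquad m(x)=\inf\{\|x^*\|:x^*\in\partial J(x)\}.$$ For $D_1\subset D$, $J$ satisfies $(PS)_{D,D_1}$ if for every $c\in\mathbb R$ every sequence $(x_n)$ in $D_1$ with $J(x_n)\to c$ and $(1+\|x_n\|)\,m_D(x_n)\to 0$ has a convergent subsequence; $(PS)_{D_1}$ means $(PS)_{X,D_1}$.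 For $\mu>0$ let $D^{\pm}(\mu)=\{x\in X:\operatorname{dist}(x,\pm P)\le\mu\}$. Let $0<\mu_0<1$ and assume: (H$_1$) $x-y\in D^{\pm}(\tfrac12\mu_0)$ for all $x\in\partial D^{\pm}(\mu_0)$ and $y\in\nabla J(x)$ (for each of the two signs); (H$_2$) $J$ satisfies $(PS)_X$, $(PS)_{D^+(\mu_0),D^+(\frac34\mu_0)}$, $(PS)_{D^-(\mu_0),D^-(\frac34\mu_0)}$ and $(PS)_{D^+(\mu_0)\cap D^-(\mu_0)}$. For $r\in\mathbb R$ let $\mathbb K_r=\{x: m(x)=0,\ J(x)=r\}$, $\mathbb K_r^1=\mathbb K_r\cap(D^+(\mu_0)\cup D^-(\mu_0))$, $\mathbb K_r^2=\mathbb K_r\setminus(D^+(\mu_0)\cup D^-(\mu_0))$ and $J^{c}=\{x:J(x)\le c\}$; for $E\subset X$ and $\rho>0$ let $(E)_\rho=\{x:\operatorname{dist}(x,E)<\rho\}$, with $(\emptyset)_\rho=\emptyset$. Fix $r\in\mathbb R$ and $\delta>0$ with $(\mathbb K_r^1)_{3\delta}\cap(\mathbb K_r^2)_{3\delta}=\emptyset$.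 Then for each $\varepsilon_0>0$ there exists $0<\bar\varepsilon<\varepsilon_0$ such that for each $0<\varepsilon<\bar\varepsilon$ and each compact set $A\subset J^{r+\varepsilon}$ there exists $\eta\in C([0,1]\times X,X)$ with the following properties: 1. $\eta(t,u)=u$ if $t=0$ or $u\notin J^{-1}([r-\varepsilon_0,r+\varepsilon_0])\setminus(\mathbb K_r^2)_\delta$; 2. $\eta(1,A\setminus(\mathbb K_r^2)_{3\delta})\subset J^{r-\varepsilon}\cup\operatorname{int}D^+(\mu_0)\cup\operatorname{int}D^-(\mu_0)$, and $\eta(1,A)\subset J^{r-\varepsilon}\cup\operatorname{int}D^+(\mu_0)\cup\operatorname{int}D^-(\mu_0)$ if $\mathbb K_r^2=\emptyset$; 3. $\eta(t,\cdot)$ is a homeomorphism of $X$ for every $t\in[0,1]$; 4. $t\mapsto J(\eta(t,u))$ is non-increasing on $[0,1]$ for every $u\in X$; 5. $\eta(t,D^+(\mu_0))\subset D^+(\mu_0)$, $\eta(t,D^-(\mu_0))\subset D^-(\mu_0)$ and $\eta(t,D^+(\mu_0)\cap D^-(\mu_0))\subset D^+(\mu_0)\cap D^-(\mu_0)$ for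 every $t\in[0,1]$; 6. if $J$ is even, then $\eta(t,-u)=-\eta(t,u)$ for all $t\in[0,1]$ and $u\in X$. -/

import Mathlib

open Set Filter Topology
open scoped Pointwise

noncomputable section

namespace SignChanging

variable {X : Type*} [NormedAddCommGroup X] [NormedSpace ℝ X]

/-- A real normed space is reflexive if the canonical embedding into its bidual is onto. -/
def IsReflexiveSpace (X : Type*) [NormedAddCommGroup X] [NormedSpace ℝ X] : Prop :=
  Function.Surjective (NormedSpace.inclusionInDoubleDual ℝ X)

/-- Generalized directional derivative
`φ⁰(x; h) = limsup_{x' → x, t ↓ 0} (φ (x' + t h) - φ x') / t`.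
For a locally Lipschitz `φ` the quotients are bounded near `(x, 0⁺)`, so the real `limsup` is the
true one. -/
def genDirDeriv (φ : X → ℝ) (x h : X) : ℝ :=
  limsup (fun p : X × ℝ => (φ (p.1 + p.2 • h) - φ p.1) / p.2) (𝓝 x ×ˢ 𝓝[>] (0 : ℝ))

/-- The Clarke subdifferential `∂φ(x)`. -/
def clarkeSubdiff (φ : X → ℝ) (x : X) : Set (StrongDual ℝ X) :=
  {f | ∀ h : X, f h ≤ genDirDeriv φ x h}

/-- The (set-valued) duality map `ℱ : X* → 2^X`. -/
def dualityMap (f : StrongDual ℝ X) : Set X :=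
  {y | f y = ‖f‖ ^ 2 ∧ f y = ‖y‖ ^ 2}

/-- The set-valued gradient `∇φ(x) = ℱ(∂φ(x))`. -/
def setGrad (φ : X → ℝ) (x : X) : Set X :=
  ⋃ f ∈ clarkeSubdiff φ x, dualityMap f

/-- `sup {⟨f, x - y⟩ : y ∈ D, ‖x - y‖ < 1}`; for `x ∈ D` the set is nonempty and bounded. -/
def slopeAlong (D : Set X) (f : StrongDual ℝ X) (x : X) : ℝ :=
  sSup ((fun y => f (x - y)) '' {y | y ∈ D ∧ ‖x - y‖ < 1})

/-- The generalized slope `m_D(x)` of `φ` at `x ∈ D` relative to `D`. -/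
def relSlope (φ : X → ℝ) (D : Set X) (x : X) : ℝ :=
  sInf ((fun f => slopeAlong D f x) '' clarkeSubdiff φ x)

/-- The generalized slope `m(x) = inf {‖f‖ : f ∈ ∂φ(x)}`. -/
def slope (φ : X → ℝ) (x : X) : ℝ :=
  sInf ((fun f : StrongDual ℝ X => ‖f‖) '' clarkeSubdiff φ x)

/-- The non-smooth `C`-condition on `D₁` with respect to `D` at level `c`. -/
def CConditionAt (φ : X → ℝ) (D D₁ : Set X) (c : ℝ) : Prop :=
  ∀ x : ℕ → X, (∀ n, x n ∈ D₁) →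
    Tendsto (fun n => φ (x n)) atTop (𝓝 c) →
    Tendsto (fun n => (1 + ‖x n‖) * relSlope φ D (x n)) atTop (𝓝 0) →
    ∃ (a : X) (k : ℕ → ℕ), StrictMono k ∧ Tendsto (fun n => x (k n)) atTop (𝓝 a)

/-- `(PS)_{D, D₁}`: the non-smooth `C`-condition on `D₁` with respect to `D`, at every level. -/
def CCondition (φ : X → ℝ) (D D₁ : Set X) : Prop :=
  ∀ c : ℝ, CConditionAt φ D D₁ c

/-- `P` is a closed convex cone with `P ∩ (-P) = {0}`. -/
structure IsClosedCone (P : Set X) : Prop where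
  isClosed : IsClosed P
  convex : Convex ℝ P
  smul_mem : ∀ x ∈ P, ∀ t : ℝ, 0 ≤ t → t • x ∈ P
  inter_neg : P ∩ (-P) = {0}

/-- `D⁺(μ) = {x : dist(x, P) ≤ μ}`. -/
def DPlus (P : Set X) (μ : ℝ) : Set X := {x | Metric.infDist x P ≤ μ}

/-- `D⁻(μ) = {x : dist(x, -P) ≤ μ}`. -/
def DMinus (P : Set X) (μ : ℝ) : Set X := {x | Metric.infDist x (-P) ≤ μ}

/-- `(I - ∇J)(∂D^±(μ₀)) ⊆ D^±(μ₀/2)`. -/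
def CondH1 (J : X → ℝ) (P : Set X) (μ₀ : ℝ) : Prop :=
  (∀ x ∈ frontier (DPlus P μ₀), ∀ y ∈ setGrad J x, x - y ∈ DPlus P (μ₀ / 2)) ∧
  (∀ x ∈ frontier (DMinus P μ₀), ∀ y ∈ setGrad J x, x - y ∈ DMinus P (μ₀ / 2))

/-- `(PS)_X`, `(PS)_{D⁺(μ₀), D⁺(3μ₀/4)}`, `(PS)_{D⁻(μ₀), D⁻(3μ₀/4)}` and `(PS)_{D⁺(μ₀) ∩ D⁻(μ₀)}`,
where `(PS)_{D₁}` abbreviates `(PS)_{X, D₁}`. -/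
def CondH2 (J : X → ℝ) (P : Set X) (μ₀ : ℝ) : Prop :=
  CCondition J univ univ ∧
  CCondition J (DPlus P μ₀) (DPlus P (3 / 4 * μ₀)) ∧
  CCondition J (DMinus P μ₀) (DMinus P (3 / 4 * μ₀)) ∧
  CCondition J univ (DPlus P μ₀ ∩ DMinus P μ₀)

/-- `K_r`: the critical points of `J` at level `r`. -/
def critLevel (J : X → ℝ) (r : ℝ) : Set X := {x | slope J x = 0 ∧ J x = r}

/-- `K_r¹ = K_r ∩ (D⁺(μ₀) ∪ D⁻(μ₀))`. -/
def critInner (J : X → ℝ) (P : Set X) (μ₀ r : ℝ) : Set X :=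
  critLevel J r ∩ (DPlus P μ₀ ∪ DMinus P μ₀)

/-- `K_r² = K_r \ (D⁺(μ₀) ∪ D⁻(μ₀))`. -/
def critOuter (J : X → ℝ) (P : Set X) (μ₀ r : ℝ) : Set X :=
  critLevel J r \ (DPlus P μ₀ ∪ DMinus P μ₀)

/-- The sublevel set `J^c = {x : J x ≤ c}`. -/
def sublevel (J : X → ℝ) (c : ℝ) : Set X := {x | J x ≤ c}

end SignChanging

end

/-!
# A deformation lemma preserving cone neighbourhoods

The deformation is the flow of a descending vector field, run for the time `2 ε`.

*Direction at one point.* If `m = m(x) > 0`, the sandwich form of the Hahn–Banach theorem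
(`exists_mem_clarkeSubdiff_norm_le`) yields directions in which `J⁰(x; ·)` is almost `-m`, and
reflexivity turns them into an exact one. Scaled by `m` and reversed it is an element `y` of the
set-valued gradient itself with `J⁰(x; -y) ≤ -m²` and `‖y‖ = m` (`exists_mem_setGrad`). Hence the
boundary condition applies to this `y`: on the boundary of a cone neighbourhood `-y` points strictly
inwards.

*Vector field.* The compactness condition makes `(1 + ‖x‖) m(x)` bounded below near level `r` away
from the open cone neighbourhoods and from the outer critical set
(`exists_slope_lower_bound`). After rescaling to unit descent, the directions have at most linear
growth. Descent (`DescendsAt`), growth and pointing inwards (`PointsInward`) are convex conditions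
which persist for a constant vector in a neighbourhood, so they admit a locally Lipschitz selection
(`exists_locallyLipschitz_forall_mem_convex_of_local_const`), which can be made odd when `J` is even
(`exists_admissible_field`). The zero vector is used where the deformation has to be the identity.

*Flow.* A locally Lipschitz field of linear growth has a global continuous flow (`exists_flow`).
It preserves the cone neighbourhoods (`mem_dPlus_of_isIntegralCurve`) and, being a homeomorphism
at each time, their interiors; `J` decreases along it at the prescribed rate
(`le_sub_mul_of_isIntegralCurve`). As the critical set at level `r` is bounded, an orbit needs a
definite time to cross the shell between the neighbourhoods of radius `2 δ` and `3 δ` of the outer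
critical set. For small `ε` an orbit starting outside the larger one therefore descends at unit rate
until it reaches level `r - ε` or enters one of the open cone neighbourhoods.
-/

namespace SignChanging

variable {X : Type*} [NormedAddCommGroup X] [NormedSpace ℝ X]

/-! ### Generalized directional derivatives and the Clarke subdifferential -/

lemma tendsto_add_smul_nhds (x h : X) :
    Tendsto (fun p : X × ℝ => p.1 + p.2 • h) (𝓝 x ×ˢ 𝓝[>] (0 : ℝ)) (𝓝 x) := by
  have h1 : Tendsto (fun p : X × ℝ => p.1 + p.2 • h) (𝓝 (x, 0)) (𝓝 (x + (0 : ℝ) • h)) :=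
    Continuous.tendsto (by fun_prop) _
  rw [zero_smul, add_zero, nhds_prod_eq] at h1
  exact h1.mono_left (Filter.prod_mono le_rfl nhdsWithin_le_nhds)

lemma eventually_snd_pos {Y : Type*} [TopologicalSpace Y] (x : Y) :
    ∀ᶠ p : Y × ℝ in 𝓝 x ×ˢ 𝓝[>] (0 : ℝ), 0 < p.2 :=
  tendsto_snd.eventually (eventually_mem_nhdsWithin)

lemma exists_abs_quotient_le {J : X → ℝ} (hJ : LocallyLipschitz J) (x : X) :
    ∃ L : ℝ, 0 ≤ L ∧ ∀ h : X, ∀ᶠ p : X × ℝ in 𝓝 x ×ˢ 𝓝[>] (0 : ℝ),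
      |(J (p.1 + p.2 • h) - J p.1) / p.2| ≤ L * ‖h‖ := by
  obtain ⟨K, t, ht, hK⟩ := hJ x
  refine ⟨K, K.2, fun h => ?_⟩
  filter_upwards [eventually_snd_pos x, (tendsto_add_smul_nhds x h).eventually ht,
    tendsto_fst.eventually ht] with p hp h1 h2
  have := hK.dist_le_mul _ h1 _ h2
  rw [Real.dist_eq, dist_eq_norm, add_sub_cancel_left, norm_smul, Real.norm_of_nonneg hp.le] at this
  rw [abs_div, abs_of_pos hp, div_le_iff₀ hp]
  linarith

lemma isBoundedUnder_quotient {J : X → ℝ} (hJ : LocallyLipschitz J) (x h : X) :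
    IsBoundedUnder (· ≤ ·) (𝓝 x ×ˢ 𝓝[>] (0 : ℝ))
      (fun p : X × ℝ => (J (p.1 + p.2 • h) - J p.1) / p.2) := by
  obtain ⟨L, -, hL⟩ := exists_abs_quotient_le hJ x
  exact isBoundedUnder_of_eventually_le ((hL h).mono fun p hp => (abs_le.1 hp).2)

lemma isCoboundedUnder_quotient {J : X → ℝ} (hJ : LocallyLipschitz J) (x h : X) :
    IsCoboundedUnder (· ≤ ·) (𝓝 x ×ˢ 𝓝[>] (0 : ℝ))
      (fun p : X × ℝ => (J (p.1 + p.2 • h) - J p.1) / p.2) := by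
  obtain ⟨L, -, hL⟩ := exists_abs_quotient_le hJ x
  exact (isBoundedUnder_of_eventually_ge
    ((hL h).mono fun p hp => (abs_le.1 hp).1)).isCoboundedUnder_le

lemma genDirDeriv_le_of_eventually {J : X → ℝ} (hJ : LocallyLipschitz J) {x h : X} {c : ℝ}
    (H : ∀ᶠ p : X × ℝ in 𝓝 x ×ˢ 𝓝[>] (0 : ℝ), (J (p.1 + p.2 • h) - J p.1) / p.2 ≤ c) :
    genDirDeriv J x h ≤ c :=
  limsup_le_of_le (isCoboundedUnder_quotient hJ x h) H

lemma eventually_lt_of_genDirDeriv_lt {J : X → ℝ} (hJ : LocallyLipschitz J) {x h : X} {c : ℝ}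
    (H : genDirDeriv J x h < c) :
    ∀ᶠ p : X × ℝ in 𝓝 x ×ˢ 𝓝[>] (0 : ℝ), (J (p.1 + p.2 • h) - J p.1) / p.2 < c :=
  eventually_lt_of_limsup_lt H (isBoundedUnder_quotient hJ x h)

lemma exists_abs_genDirDeriv_le {J : X → ℝ} (hJ : LocallyLipschitz J) (x : X) :
    ∃ L : ℝ, 0 ≤ L ∧ ∀ h : X, |genDirDeriv J x h| ≤ L * ‖h‖ := by
  obtain ⟨L, hL0, hL⟩ := exists_abs_quotient_le hJ x
  refine ⟨L, hL0, fun h => abs_le.2 ⟨?_, ?_⟩⟩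
  · by_contra hlt
    obtain ⟨p, hp1, hp2⟩ :=
      ((eventually_lt_of_genDirDeriv_lt hJ (not_le.1 hlt)).and (hL h)).exists
    linarith [(abs_le.1 hp2).1]
  · exact genDirDeriv_le_of_eventually hJ ((hL h).mono fun p hp => (abs_le.1 hp).2)

lemma genDirDeriv_add_le {J : X → ℝ} (hJ : LocallyLipschitz J) (x h k : X) :
    genDirDeriv J x (h + k) ≤ genDirDeriv J x h + genDirDeriv J x k := by
  refine le_of_forall_pos_le_add fun e he => ?_
  have h1 := eventually_lt_of_genDirDeriv_lt hJ (x := x) (h := h)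
    (show _ < genDirDeriv J x h + e / 2 by linarith)
  have h2 := eventually_lt_of_genDirDeriv_lt hJ (x := x) (h := k)
    (show _ < genDirDeriv J x k + e / 2 by linarith)
  have ht : Tendsto (fun p : X × ℝ => (p.1 + p.2 • k, p.2)) (𝓝 x ×ˢ 𝓝[>] (0 : ℝ))
      (𝓝 x ×ˢ 𝓝[>] (0 : ℝ)) := (tendsto_add_smul_nhds x k).prodMk tendsto_snd
  refine genDirDeriv_le_of_eventually hJ ?_
  filter_upwards [ht.eventually h1, h2] with p hp1 hp2
  have : p.1 + p.2 • (h + k) = p.1 + p.2 • k + p.2 • h := by rw [smul_add]; abel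
  rw [this]
  have h3 : (J (p.1 + p.2 • k + p.2 • h) - J p.1) / p.2 =
      (J (p.1 + p.2 • k + p.2 • h) - J (p.1 + p.2 • k)) / p.2 +
        (J (p.1 + p.2 • k) - J p.1) / p.2 := by ring
  rw [h3]
  linarith

lemma tendsto_mul_snd {Y : Type*} [TopologicalSpace Y] {x : Y} {a : ℝ} (ha : 0 < a) :
    Tendsto (fun p : Y × ℝ => (p.1, a * p.2)) (𝓝 x ×ˢ 𝓝[>] (0 : ℝ)) (𝓝 x ×ˢ 𝓝[>] (0 : ℝ)) := by
  refine tendsto_fst.prodMk (tendsto_nhdsWithin_iff.2 ⟨?_, ?_⟩)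
  · have : Tendsto (fun p : Y × ℝ => a * p.2) (𝓝 x ×ˢ 𝓝[>] (0 : ℝ)) (𝓝 (a * 0)) :=
      (tendsto_snd.mono_right nhdsWithin_le_nhds).const_mul a
    simpa using this
  · filter_upwards [eventually_snd_pos x] with p hp
    exact mul_pos ha hp

lemma genDirDeriv_smul_le {J : X → ℝ} (hJ : LocallyLipschitz J) (x h : X) {a : ℝ} (ha : 0 < a) :
    genDirDeriv J x (a • h) ≤ a * genDirDeriv J x h := by
  refine le_of_forall_pos_le_add fun e he => genDirDeriv_le_of_eventually hJ ?_
  have h1 := eventually_lt_of_genDirDeriv_lt hJ (x := x) (h := h)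
    (show _ < genDirDeriv J x h + e / a by linarith [div_pos he ha])
  filter_upwards [(tendsto_mul_snd ha).eventually h1, eventually_snd_pos x] with p hp hp2
  rw [div_lt_iff₀ (mul_pos ha hp2)] at hp
  rw [div_le_iff₀ hp2, smul_smul, mul_comm p.2 a]
  have : (genDirDeriv J x h + e / a) * (a * p.2) = (a * genDirDeriv J x h + e) * p.2 := by
    field_simp
  linarith

lemma genDirDeriv_smul {J : X → ℝ} (hJ : LocallyLipschitz J) (x h : X) {a : ℝ} (ha : 0 < a) :
    genDirDeriv J x (a • h) = a * genDirDeriv J x h := by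
  refine le_antisymm (genDirDeriv_smul_le hJ x h ha) ?_
  have := genDirDeriv_smul_le hJ x (a • h) (inv_pos.2 ha)
  rw [smul_smul, inv_mul_cancel₀ ha.ne', one_smul] at this
  calc a * genDirDeriv J x h ≤ a * (a⁻¹ * genDirDeriv J x (a • h)) := by gcongr
    _ = genDirDeriv J x (a • h) := by field_simp

/-- A linear functional dominated by `J⁰(x; ·)` is automatically continuous. -/
lemma exists_mem_clarkeSubdiff_of_linear {J : X → ℝ} (hJ : LocallyLipschitz J) {x : X}
    (g : X →ₗ[ℝ] ℝ) (hg : ∀ h, g h ≤ genDirDeriv J x h) :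
    ∃ f ∈ clarkeSubdiff J x, ∀ h, f h = g h := by
  obtain ⟨L, -, hL⟩ := exists_abs_genDirDeriv_le hJ x
  refine ⟨g.mkContinuous L fun h => ?_, fun h => hg h, fun h => rfl⟩
  rw [Real.norm_eq_abs, abs_le]
  have h1 := (hg h).trans (le_abs_self _) |>.trans (hL h)
  have h2 := (hg (-h)).trans (le_abs_self _) |>.trans (hL (-h))
  rw [map_neg, norm_neg] at h2
  exact ⟨by linarith, h1⟩

/-- Sandwich form of the Hahn–Banach theorem: if `-m ‖·‖ ≤ J⁰(x; ·)`, some subgradient lies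
between the two. -/
lemma exists_mem_clarkeSubdiff_norm_le {J : X → ℝ} (hJ : LocallyLipschitz J) {x : X} {m : ℝ}
    (hm : 0 ≤ m) (H : ∀ k, 0 ≤ genDirDeriv J x k + m * ‖k‖) :
    ∃ f ∈ clarkeSubdiff J x, ‖f‖ ≤ m := by
  -- Extend the zero functional from the diagonal of `X × X`, where it is dominated by
  -- `(h, k) ↦ J⁰(x; h) + m ‖k‖`.
  let S : (X × X) →ₗ.[ℝ] ℝ :=
    ⟨LinearMap.range ((LinearMap.id : X →ₗ[ℝ] X).prod LinearMap.id), 0⟩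
  obtain ⟨g, hg0, hg⟩ := exists_extension_of_le_sublinear S
    (fun z => genDirDeriv J x z.1 + m * ‖z.2‖)
    (fun c hc z => by
      simp only [Prod.smul_fst, Prod.smul_snd, genDirDeriv_smul hJ x _ hc, norm_smul,
        Real.norm_of_nonneg hc.le]
      ring)
    (fun z w => by
      have h1 := genDirDeriv_add_le hJ x z.1 w.1
      have h2 := mul_le_mul_of_nonneg_left (norm_add_le z.2 w.2) hm
      simp only [Prod.fst_add, Prod.snd_add]
      linarith)
    (by
      rintro ⟨_, ⟨k, rfl⟩⟩
      exact H k)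
  have hdiag : ∀ k : X, g (k, k) = 0 := fun k => hg0 ⟨(k, k), ⟨k, rfl⟩⟩
  have hp0 : genDirDeriv J x 0 ≤ 0 := by
    have := genDirDeriv_smul hJ x 0 (a := 2) two_pos
    rw [smul_zero] at this
    linarith
  obtain ⟨f, hf, hfg⟩ := exists_mem_clarkeSubdiff_of_linear hJ (x := x)
    (g.comp (LinearMap.inl ℝ X X)) (fun h => by simpa using hg (h, 0))
  refine ⟨f, hf, f.opNorm_le_bound hm fun h => ?_⟩
  have key : ∀ k : X, f k ≤ m * ‖k‖ := fun k => by
    have h1 : f k = g (k, 0) := by rw [hfg]; rfl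
    have h2 : g (k, 0) = g (0, -k) := by
      have : ((k, 0) : X × X) = (k, k) + (0, -k) := by simp
      rw [this, map_add, hdiag, zero_add]
    have h3 := hg (0, -k)
    simp only [norm_neg] at h3
    linarith
  rw [Real.norm_eq_abs, abs_le]
  have := key (-h)
  rw [map_neg, norm_neg] at this
  exact ⟨by linarith, key h⟩

lemma clarkeSubdiff_nonempty {J : X → ℝ} (hJ : LocallyLipschitz J) (x : X) :
    (clarkeSubdiff J x).Nonempty := by
  obtain ⟨L, hL0, hL⟩ := exists_abs_genDirDeriv_le hJ x
  obtain ⟨f, hf, -⟩ := exists_mem_clarkeSubdiff_norm_le hJ (x := x) hL0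
    (fun k => by linarith [(abs_le.1 (hL k)).1])
  exact ⟨f, hf⟩

/-- Max formula: `J⁰(x; ·)` is the support function of `∂J(x)`. -/
lemma exists_mem_clarkeSubdiff_eq {J : X → ℝ} (hJ : LocallyLipschitz J) (x : X) {h : X}
    (hh : h ≠ 0) : ∃ f ∈ clarkeSubdiff J x, f h = genDirDeriv J x h := by
  obtain ⟨g, hg1, hg2⟩ := exists_extension_of_le_sublinear
    (LinearPMap.mkSpanSingleton h (genDirDeriv J x h) hh) (genDirDeriv J x)
    (fun c hc z => genDirDeriv_smul hJ x z hc) (genDirDeriv_add_le hJ x)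
    (by
      rintro ⟨z, hz⟩
      obtain ⟨t, rfl⟩ := Submodule.mem_span_singleton.1 hz
      have : (LinearPMap.mkSpanSingleton h (genDirDeriv J x h) hh) ⟨t • h, hz⟩ =
          t • genDirDeriv J x h := LinearPMap.mkSpanSingleton'_apply _ _ _ _ _
      rw [this, smul_eq_mul]
      have hp0 : genDirDeriv J x 0 = 0 := by
        have := genDirDeriv_smul hJ x 0 (a := 2) two_pos
        rw [smul_zero] at this
        linarith
      rcases lt_trichotomy t 0 with ht | ht | ht
      · have h1 := genDirDeriv_add_le hJ x (t • h) ((-t) • h)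
        rw [neg_smul, add_neg_cancel, hp0, ← neg_smul, genDirDeriv_smul hJ x h (neg_pos.2 ht)] at h1
        simp only
        linarith
      · simp [ht, hp0]
      · rw [genDirDeriv_smul hJ x h ht])
  obtain ⟨f, hf, hfg⟩ := exists_mem_clarkeSubdiff_of_linear hJ g hg2
  refine ⟨f, hf, ?_⟩
  have hmem : h ∈ (LinearPMap.mkSpanSingleton h (genDirDeriv J x h) hh : X →ₗ.[ℝ] ℝ).domain :=
    Submodule.mem_span_singleton_self (R := ℝ) h
  rw [hfg]
  exact (hg1 ⟨h, hmem⟩).trans (LinearPMap.mkSpanSingleton_apply ℝ ℝ (σ := RingHom.id ℝ) hh _)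

/-! ### The slope -/

lemma slope_nonneg (J : X → ℝ) (x : X) : 0 ≤ slope J x :=
  Real.sInf_nonneg (by rintro _ ⟨f, -, rfl⟩; exact norm_nonneg f)

lemma slope_le_norm {J : X → ℝ} {x : X} {f : StrongDual ℝ X} (hf : f ∈ clarkeSubdiff J x) :
    slope J x ≤ ‖f‖ :=
  csInf_le ⟨0, by rintro _ ⟨f, -, rfl⟩; exact norm_nonneg f⟩ ⟨f, hf, rfl⟩

lemma le_slope {J : X → ℝ} (hJ : LocallyLipschitz J) {x : X} {c : ℝ}
    (H : ∀ f ∈ clarkeSubdiff J x, c ≤ ‖f‖) : c ≤ slope J x :=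
  le_csInf ((clarkeSubdiff_nonempty hJ x).image _) (by rintro _ ⟨f, hf, rfl⟩; exact H f hf)

/-- The infimum defining the slope is attained. -/
lemma exists_norm_eq_slope {J : X → ℝ} (hJ : LocallyLipschitz J) (x : X) :
    ∃ f ∈ clarkeSubdiff J x, ‖f‖ = slope J x := by
  obtain ⟨f, hf, hfm⟩ := exists_mem_clarkeSubdiff_norm_le hJ (x := x) (slope_nonneg J x) (by
    intro k
    by_contra! hlt
    have hk : 0 < ‖k‖ := by
      rcases (norm_nonneg k).eq_or_lt with h0 | h0
      · have hk0 : k = 0 := norm_eq_zero.1 h0.symm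
        have := genDirDeriv_smul hJ x 0 (a := 2) two_pos
        rw [smul_zero] at this
        rw [hk0, norm_zero, mul_zero] at hlt
        linarith
      · exact h0
    have : -genDirDeriv J x k / ‖k‖ ≤ slope J x := le_slope hJ fun f hf => by
      rw [div_le_iff₀ hk]
      have h1 := hf k
      have h2 := (neg_le_abs (f k)).trans (f.le_opNorm k)
      linarith
    rw [div_le_iff₀ hk] at this
    linarith)
  exact ⟨f, hf, le_antisymm hfm (slope_le_norm hf)⟩

/-- Every rate below the slope is attained by the generalized derivative in some unit direction. -/
lemma exists_genDirDeriv_lt {J : X → ℝ} (hJ : LocallyLipschitz J) {x : X} {m : ℝ}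
    (hm : 0 ≤ m) (hlt : m < slope J x) : ∃ h : X, ‖h‖ = 1 ∧ genDirDeriv J x h < -m := by
  by_contra! H
  obtain ⟨f, hf, hfm⟩ := exists_mem_clarkeSubdiff_norm_le hJ (x := x) hm (fun k => by
    by_cases hk : k = 0
    · have := genDirDeriv_smul hJ x 0 (a := 2) two_pos
      rw [smul_zero] at this
      rw [hk, norm_zero, mul_zero]
      linarith
    · have hk' : 0 < ‖k‖ := norm_pos_iff.2 hk
      have h1 := H (‖k‖⁻¹ • k) (by
        rw [norm_smul, norm_inv, norm_norm, inv_mul_cancel₀ hk'.ne'])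
      rw [genDirDeriv_smul hJ x k (inv_pos.2 hk')] at h1
      have h2 := mul_le_mul_of_nonneg_left h1 hk'.le
      rw [mul_inv_cancel_left₀ hk'.ne'] at h2
      linarith)
  exact absurd (slope_le_norm hf) (not_le.2 (hfm.trans_lt hlt))

/-- In a reflexive space the steepest descent direction exists and, suitably normalized, belongs
to the set-valued gradient. It is a weak limit of almost steepest directions. -/
lemma exists_mem_setGrad {J : X → ℝ} (hX : IsReflexiveSpace X) (hJ : LocallyLipschitz J) {x : X}
    (hpos : 0 < slope J x) :
    ∃ y ∈ setGrad J x, ‖y‖ = slope J x ∧ genDirDeriv J x (-y) ≤ -slope J x ^ 2 := by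
  set m := slope J x with hm
  obtain ⟨f₀, hf₀, hf₀m⟩ := exists_norm_eq_slope hJ x
  have hex : ∀ n : ℕ, ∃ h : X, ‖h‖ = 1 ∧ genDirDeriv J x h < -(m * (1 - 1 / ((n : ℝ) + 1))) := by
    intro n
    have h1 : (0 : ℝ) < 1 / ((n : ℝ) + 1) := by positivity
    have h2 : 1 / ((n : ℝ) + 1) ≤ 1 := by
      rw [div_le_one (by positivity)]; linarith [n.cast_nonneg (α := ℝ)]
    exact exists_genDirDeriv_lt hJ (mul_nonneg hpos.le (by linarith)) (by nlinarith)
  choose h hh1 hh2 using hex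
  let φ : ℕ → WeakDual ℝ (StrongDual ℝ X) :=
    fun n => StrongDual.toWeakDual (NormedSpace.inclusionInDoubleDual ℝ X (h n))
  have hcpt := WeakDual.isCompact_closedBall (𝕜 := ℝ) (E := StrongDual ℝ X) 0 1
  have hmem : ∀ n, φ n ∈ WeakDual.toStrongDual ⁻¹' Metric.closedBall
      (0 : StrongDual ℝ (StrongDual ℝ X)) 1 := fun n => by
    exact (dist_zero_right (NormedSpace.inclusionInDoubleDual ℝ X (h n))).le.trans <|
      (NormedSpace.double_dual_bound ℝ X (h n)).trans (hh1 n).le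
  obtain ⟨Φ, hΦ1, hΦ2⟩ := hcpt.ultrafilter_le_nhds ((hyperfilter ℕ).map φ)
    (by
      rw [Ultrafilter.coe_map, le_principal_iff, mem_map]
      exact Filter.univ_mem' hmem)
  have hlim : Tendsto φ (hyperfilter ℕ) (𝓝 Φ) := hΦ2
  obtain ⟨k, hk⟩ := hX (WeakDual.toStrongDual Φ)
  have hk1 : ‖k‖ ≤ 1 := by
    rw [← (NormedSpace.inclusionInDoubleDualLi (E := X) ℝ).norm_map k]
    have : NormedSpace.inclusionInDoubleDualLi (E := X) ℝ k = WeakDual.toStrongDual Φ := hk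
    rw [this]
    simpa using hΦ1
  have hfk : ∀ f ∈ clarkeSubdiff J x, f k ≤ -m := by
    intro f hf
    have hev : Tendsto (fun n => f (h n)) (hyperfilter ℕ) (𝓝 (f k)) := by
      have h1 := ((WeakDual.eval_continuous f).tendsto Φ).comp hlim
      have h2 : Φ f = f k := by
        have : NormedSpace.inclusionInDoubleDual ℝ X k f = WeakDual.toStrongDual Φ f := by rw [hk]
        exact this.symm
      rw [h2] at h1
      exact h1
    have hright : Tendsto (fun n : ℕ => -(m * (1 - 1 / ((n : ℝ) + 1)))) (hyperfilter ℕ)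
        (𝓝 (-m)) := by
      have h0 := tendsto_one_div_add_atTop_nhds_zero_nat (𝕜 := ℝ)
      have h1 := ((h0.const_sub 1).const_mul m).neg
      simp only [sub_zero, mul_one] at h1
      exact h1.mono_left Nat.hyperfilter_le_atTop
    exact le_of_tendsto_of_tendsto' hev hright fun n => (hf (h n)).trans (hh2 n).le
  have hk0 : k ≠ 0 := by
    rintro rfl
    have := hfk f₀ hf₀
    rw [map_zero] at this
    linarith
  have hval : f₀ (-(m • k)) = m ^ 2 ∧ ‖-(m • k)‖ = m := by
    have h1 := hfk f₀ hf₀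
    have h2 := (neg_le_abs (f₀ k)).trans (f₀.le_opNorm k)
    rw [hf₀m] at h2
    have h3 : ‖k‖ = 1 := by
      refine le_antisymm hk1 ?_
      by_contra! hlt
      nlinarith
    rw [h3] at h2
    refine ⟨?_, by rw [norm_neg, norm_smul, h3, Real.norm_of_nonneg hpos.le, mul_one]⟩
    rw [map_neg, map_smul, smul_eq_mul]
    have : f₀ k = -m := le_antisymm h1 (by linarith)
    rw [this]; ring
  refine ⟨-(m • k), mem_biUnion hf₀ ⟨?_, ?_⟩, hval.2, ?_⟩
  · rw [hval.1, hf₀m]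
  · rw [hval.1, hval.2]
  · rw [neg_neg, genDirDeriv_smul hJ x k hpos]
    obtain ⟨f, hf, hfe⟩ := exists_mem_clarkeSubdiff_eq hJ x hk0
    rw [← hfe]
    nlinarith [hfk f hf]

lemma zero_mem_setGrad {J : X → ℝ} (hJ : LocallyLipschitz J) {x : X} (h0 : slope J x = 0) :
    (0 : X) ∈ setGrad J x := by
  obtain ⟨f, hf, hfm⟩ := exists_norm_eq_slope hJ x
  have : f = 0 := norm_eq_zero.1 (hfm.trans h0)
  subst this
  exact mem_biUnion hf (by simp [dualityMap])

lemma slopeAlong_univ (f : StrongDual ℝ X) (x : X) : slopeAlong univ f x = ‖f‖ := by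
  have hset : (fun y => f (x - y)) '' {y | y ∈ univ ∧ ‖x - y‖ < 1} = f '' Metric.ball 0 1 := by
    ext c
    constructor
    · rintro ⟨y, ⟨-, hy⟩, rfl⟩
      exact ⟨x - y, by simpa using hy, rfl⟩
    · rintro ⟨z, hz, rfl⟩
      exact ⟨x - z, ⟨mem_univ _, by simpa using hz⟩, by simp⟩
  rw [slopeAlong, hset]
  refine csSup_eq_of_forall_le_of_forall_lt_exists_gt ⟨f 0, 0, by simp, rfl⟩ ?_ ?_
  · rintro _ ⟨z, hz, rfl⟩
    exact (le_abs_self _).trans (f.unit_le_opNorm z (by simpa using (mem_ball_zero_iff.1 hz).le))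
  · intro w hw
    obtain ⟨z, hz, hwz⟩ := f.exists_lt_apply_of_lt_opNorm hw
    rcases abs_cases (f z) with ⟨h1, -⟩ | ⟨h1, -⟩
    · exact ⟨f z, ⟨z, by simpa using hz, rfl⟩, by rw [← h1]; exact hwz⟩
    · exact ⟨f (-z), ⟨-z, by simpa using hz, rfl⟩, by rw [map_neg, ← h1]; exact hwz⟩

lemma relSlope_univ (J : X → ℝ) (x : X) : relSlope J univ x = slope J x := by
  simp only [relSlope, slope, slopeAlong_univ]

/-! ### Directions of uniform local descent -/

/-- `J` descends along `h` at rate at least `c`, uniformly near `x`. This is an open condition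
on `x`, which holds as soon as `J⁰(x; h) < -c`. -/
def DescendsAt (J : X → ℝ) (x h : X) (c : ℝ) : Prop :=
  ∀ᶠ p : X × ℝ in 𝓝 x ×ˢ 𝓝[>] (0 : ℝ), J (p.1 + p.2 • h) ≤ J p.1 - c * p.2

lemma descendsAt_of_genDirDeriv_lt {J : X → ℝ} (hJ : LocallyLipschitz J) {x h : X} {c : ℝ}
    (H : genDirDeriv J x h < -c) : DescendsAt J x h c := by
  filter_upwards [eventually_lt_of_genDirDeriv_lt hJ H, eventually_snd_pos x] with p hp hp2
  rw [div_lt_iff₀ hp2] at hp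
  linarith

lemma DescendsAt.genDirDeriv_le {J : X → ℝ} (hJ : LocallyLipschitz J) {x h : X} {c : ℝ}
    (H : DescendsAt J x h c) : genDirDeriv J x h ≤ -c := by
  refine genDirDeriv_le_of_eventually hJ ?_
  filter_upwards [H, eventually_snd_pos x] with p hp hp2
  rw [div_le_iff₀ hp2]
  linarith

lemma DescendsAt.eventually {J : X → ℝ} {x h : X} {c : ℝ} (H : DescendsAt J x h c) :
    ∀ᶠ y in 𝓝 x, DescendsAt J y h c := by
  obtain ⟨pa, ha, pb, hb, hab⟩ := Filter.eventually_prod_iff.1 H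
  filter_upwards [ha.eventually_nhds] with y hy
  exact Filter.eventually_prod_iff.2 ⟨pa, hy, pb, hb, hab⟩

lemma descendsAt_zero (J : X → ℝ) (x : X) : DescendsAt J x 0 0 :=
  Eventually.of_forall fun p => by simp

lemma DescendsAt.mono {J : X → ℝ} {x h : X} {c d : ℝ} (H : DescendsAt J x h c) (hdc : d ≤ c) :
    DescendsAt J x h d := by
  filter_upwards [H, eventually_snd_pos x] with p hp hp2
  nlinarith

lemma DescendsAt.smul {J : X → ℝ} {x h : X} {c a : ℝ} (H : DescendsAt J x h c) (ha : 0 ≤ a) :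
    DescendsAt J x (a • h) (a * c) := by
  rcases ha.eq_or_lt with rfl | ha
  · simpa using descendsAt_zero J x
  · have := (tendsto_mul_snd (x := x) ha).eventually H
    filter_upwards [this] with p hp
    rw [smul_smul, mul_comm p.2 a]
    linarith

lemma DescendsAt.add {J : X → ℝ} {x h k : X} {c d : ℝ} (H : DescendsAt J x h c)
    (H' : DescendsAt J x k d) : DescendsAt J x (h + k) (c + d) := by
  have ht : Tendsto (fun p : X × ℝ => (p.1 + p.2 • k, p.2)) (𝓝 x ×ˢ 𝓝[>] (0 : ℝ))
      (𝓝 x ×ˢ 𝓝[>] (0 : ℝ)) := (tendsto_add_smul_nhds x k).prodMk tendsto_snd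
  filter_upwards [ht.eventually H, H'] with p hp1 hp2
  have : p.1 + p.2 • (h + k) = p.1 + p.2 • k + p.2 • h := by rw [smul_add]; abel
  rw [this]
  linarith

lemma DescendsAt.convex (J : X → ℝ) (x : X) (c : ℝ) : Convex ℝ {y | DescendsAt J x (-y) c} := by
  intro y hy z hz a b ha hb hab
  have := (DescendsAt.smul hy ha).add (DescendsAt.smul hz hb)
  rw [← add_mul, hab, one_mul] at this
  simpa [neg_add_rev, add_comm] using this

lemma DescendsAt.neg {J : X → ℝ} (heven : ∀ u, J (-u) = J u) {x h : X} {c : ℝ}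
    (H : DescendsAt J x h c) : DescendsAt J (-x) (-h) c := by
  have ht : Tendsto (fun p : X × ℝ => (-p.1, p.2)) (𝓝 (-x) ×ˢ 𝓝[>] (0 : ℝ))
      (𝓝 x ×ˢ 𝓝[>] (0 : ℝ)) := by
    refine Tendsto.prodMk ?_ tendsto_snd
    have := (continuous_neg.tendsto (-x)).comp (tendsto_fst (f := 𝓝 (-x)) (g := 𝓝[>] (0 : ℝ)))
    rwa [neg_neg] at this
  filter_upwards [ht.eventually H] with p hp
  have h1 : p.1 + p.2 • -h = -(-p.1 + p.2 • h) := by rw [smul_neg]; abel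
  rw [h1, heven]
  simpa [heven] using hp

/-- A point is critical iff no direction descends at a positive rate. -/
lemma slope_pos_iff {J : X → ℝ} (hJ : LocallyLipschitz J) {x : X} :
    0 < slope J x ↔ ∃ h c, 0 < c ∧ DescendsAt J x h c := by
  constructor
  · intro hpos
    obtain ⟨h, -, hh⟩ := exists_genDirDeriv_lt hJ (x := x) (m := slope J x / 2)
      (by linarith) (by linarith)
    exact ⟨h, slope J x / 2, by linarith, descendsAt_of_genDirDeriv_lt hJ hh⟩
  · rintro ⟨h, c, hc, H⟩
    obtain ⟨f, hf, hfm⟩ := exists_norm_eq_slope hJ x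
    by_contra! hle
    have : f = 0 := norm_eq_zero.1 (le_antisymm (hfm.trans_le hle) (norm_nonneg f))
    have h1 := (hf h).trans (H.genDirDeriv_le hJ)
    rw [this] at h1
    simp at h1
    linarith

lemma slope_neg_eq_zero {J : X → ℝ} (hJ : LocallyLipschitz J) (heven : ∀ u, J (-u) = J u) {x : X}
    (h0 : slope J x = 0) : slope J (-x) = 0 := by
  by_contra hne
  obtain ⟨h, c, hc, H⟩ := (slope_pos_iff hJ).1 (lt_of_le_of_ne (slope_nonneg J (-x)) (Ne.symm hne))
  have := H.neg heven
  rw [neg_neg] at this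
  exact ((slope_pos_iff hJ).2 ⟨_, c, hc, this⟩).ne' h0

/-- Limits of almost critical points are critical. -/
lemma slope_eq_zero_of_tendsto {J : X → ℝ} (hJ : LocallyLipschitz J) {x : ℕ → X} {a : X}
    (hx : Tendsto x atTop (𝓝 a)) (hs : Tendsto (fun n => slope J (x n)) atTop (𝓝 0)) :
    slope J a = 0 := by
  by_contra hne
  obtain ⟨h, c, hc, H⟩ := (slope_pos_iff hJ).1 (lt_of_le_of_ne (slope_nonneg J a) (Ne.symm hne))
  have h1 : ∀ᶠ n in atTop, c ≤ slope J (x n) * ‖h‖ := by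
    filter_upwards [hx.eventually H.eventually] with n hn
    obtain ⟨f, hf, hfm⟩ := exists_norm_eq_slope hJ (x n)
    have h2 := (hf h).trans (hn.genDirDeriv_le hJ)
    have h3 := (neg_le_abs (f h)).trans (f.le_opNorm h)
    rw [hfm] at h3
    linarith
  have := ge_of_tendsto (hs.mul_const ‖h‖) h1
  linarith

/-! ### Locally Lipschitz selections -/

lemma exists_lipschitzWith_sum {ι Y E : Type*} [PseudoEMetricSpace Y] [SeminormedAddCommGroup E]
    (s : Finset ι) (f : ι → Y → E) (hf : ∀ i, ∃ K, LipschitzWith K (f i)) :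
    ∃ K, LipschitzWith K (fun y => ∑ i ∈ s, f i y) := by
  classical
  induction s using Finset.induction_on with
  | empty => exact ⟨0, by simpa using LipschitzWith.const (0 : E)⟩
  | insert a s ha ih =>
    obtain ⟨K, hK⟩ := ih
    obtain ⟨K', hK'⟩ := hf a
    refine ⟨K' + K, ?_⟩
    simp only [Finset.sum_insert ha]
    exact hK'.add hK

lemma locallyLipschitz_finsum {ι Y E : Type*} [PseudoEMetricSpace Y] [SeminormedAddCommGroup E]
    {f : ι → Y → E} (hf : ∀ i, ∃ K, LipschitzWith K (f i))
    (hfin : LocallyFinite fun i => Function.support (f i)) :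
    LocallyLipschitz (fun y => ∑ᶠ i, f i y) := by
  intro x
  obtain ⟨s, hs⟩ := finsum_eventually_eq_sum hfin x
  obtain ⟨K, hK⟩ := exists_lipschitzWith_sum s f hf
  exact ⟨K, _, hs, fun y hy z hz => by
    have hy' : ∑ᶠ i, f i y = ∑ i ∈ s, f i y := hy
    have hz' : ∑ᶠ i, f i z = ∑ i ∈ s, f i z := hz
    simpa only [hy', hz'] using hK y z⟩

/-- A convex-valued map on a metric space which locally admits constant selections has a locally
Lipschitz selection. -/
lemma exists_locallyLipschitz_forall_mem_convex_of_local_const {Y E : Type*} [MetricSpace Y]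
    [NormedAddCommGroup E] [NormedSpace ℝ E] {t : Y → Set E} (ht : ∀ x, Convex ℝ (t x))
    (H : ∀ x, ∃ c, ∀ᶠ y in 𝓝 x, c ∈ t y) :
    ∃ g : Y → E, LocallyLipschitz g ∧ ∀ x, g x ∈ t x := by
  choose c hc using H
  choose U hU hUo hUx using fun x => mem_nhds_iff.1 (hc x)
  obtain ⟨W, hWo, hWc, hWf, hWU⟩ := precise_refinement U hUo
    (eq_univ_of_forall fun x => mem_iUnion.2 ⟨x, hUx x⟩)
  classical
  -- The distance to an empty complement is `0` by convention, hence the case distinction.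
  let φ : Y → Y → ℝ := fun i y => if W i = univ then 1 else Metric.infDist y (W i)ᶜ
  have hφ0 : ∀ i y, 0 ≤ φ i y := fun i y => by
    simp only [φ]; split_ifs
    exacts [zero_le_one, Metric.infDist_nonneg]
  have hφW : ∀ i y, φ i y ≠ 0 → y ∈ W i := fun i y h => by
    by_contra hy
    refine h ?_
    have : W i ≠ univ := fun h' => hy (h' ▸ mem_univ y)
    simp only [φ, if_neg this]
    exact Metric.infDist_zero_of_mem hy
  have hφpos : ∀ i y, y ∈ W i → 0 < φ i y := fun i y hy => by
    by_cases h : W i = univ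
    · simp [φ, h]
    · simp only [φ, if_neg h]
      exact ((hWo i).isClosed_compl.notMem_iff_infDist_pos (nonempty_compl.2 h)).1
        (fun h' => h' hy)
  have hφL : ∀ i, ∃ K, LipschitzWith K (φ i) := fun i => by
    by_cases h : W i = univ
    · refine ⟨0, ?_⟩
      simp only [φ, if_pos h]
      exact LipschitzWith.const _
    · refine ⟨1, ?_⟩
      simp only [φ, if_neg h]
      exact Metric.lipschitz_infDist_pt _
  have hφfin : LocallyFinite fun i => Function.support (φ i) :=
    hWf.subset fun i y hy => hφW i y hy
  let S : Y → ℝ := fun y => ∑ᶠ i, φ i y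
  let N : Y → E := fun y => ∑ᶠ i, φ i y • c i
  have hS : LocallyLipschitz S := locallyLipschitz_finsum hφL hφfin
  have hN : LocallyLipschitz N := by
    refine locallyLipschitz_finsum (f := fun i y => φ i y • c i) (fun i => ?_)
      (hφfin.subset fun i => ?_)
    · obtain ⟨K, hK⟩ := hφL i
      exact ⟨_, ((ContinuousLinearMap.toSpanSingleton ℝ (c i)).lipschitz).comp hK⟩
    · exact fun y hy hy' => hy (by simp [hy'])
  have hSpos : ∀ y, 0 < S y := fun y => by
    obtain ⟨i, hi⟩ := mem_iUnion.1 (hWc ▸ mem_univ y : y ∈ ⋃ i, W i)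
    exact finsum_pos (fun i => hφ0 i y) ⟨i, hφpos i y hi⟩ (hφfin.point_finite y)
  refine ⟨fun y => (S y)⁻¹ • N y, fun x => ?_, fun x => ?_⟩
  · have hF : ContDiffAt ℝ 1 (fun z : ℝ × E => z.1⁻¹ • z.2) (S x, N x) :=
      (contDiffAt_fst.inv (hSpos x).ne').smul contDiffAt_snd
    obtain ⟨K, s, hs, hK⟩ := hF.exists_lipschitzOnWith
    obtain ⟨K', s', hs', hK'⟩ := (hS.prodMk hN) x
    exact ⟨K * K', s' ∩ (fun y => (S y, N y)) ⁻¹' s,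
      inter_mem hs' ((hS.prodMk hN).continuous.continuousAt hs),
      hK.comp (hK'.mono inter_subset_left) fun y hy => hy.2⟩
  · have hmem := (ht x).finsum_mem (w := fun i => (S x)⁻¹ * φ i x) (z := c)
      (fun i => mul_nonneg (inv_nonneg.2 (hSpos x).le) (hφ0 i x))
      (by
        rw [← mul_finsum]
        exact inv_mul_cancel₀ (hSpos x).ne')
      (fun i hi => hU i (hWU i (hφW i x (right_ne_zero_of_mul hi))))
    have : (S x)⁻¹ • N x = ∑ᶠ i, ((S x)⁻¹ * φ i x) • c i := by
      simp only [N, mul_smul]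
      exact smul_finsum _ _
    simpa only [this] using hmem

/-! ### The global flow of a locally Lipschitz vector field of linear growth -/

section Flow

variable {E : Type*} [NormedAddCommGroup E] [NormedSpace ℝ E] {v : E → E}

lemma exists_local_flow [CompleteSpace E] (hv : LocallyLipschitz v) (x₀ : E) :
    ∃ ε > 0, ∃ ρ > 0, ∃ α : E × ℝ → E, (∀ x ∈ Metric.closedBall x₀ ρ, α (x, 0) = x ∧
      IsIntegralCurveOn (fun s => α (x, s)) (fun _ => v) (Icc (-ε) ε)) ∧
      ContinuousOn α (Metric.closedBall x₀ ρ ×ˢ Icc (-ε) ε) := by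
  obtain ⟨K, t, ht, hK⟩ := hv x₀
  obtain ⟨a, ha, hat⟩ := Metric.nhds_basis_closedBall.mem_iff.1 ht
  set L : ℝ := ‖v x₀‖ + K * a with hL
  have hL0 : 0 ≤ L := by positivity
  set ε : ℝ := a / 2 / (L + 1) with hε
  have hε0 : 0 < ε := by positivity
  have hb : ∀ x ∈ Metric.closedBall x₀ a, ‖v x‖ ≤ L := fun x hx => by
    have h1 := (hK.mono hat).dist_le_mul x hx x₀ (Metric.mem_closedBall_self ha.le)
    rw [dist_eq_norm] at h1
    have h2 : (K : ℝ) * dist x x₀ ≤ K * a := by gcongr; exact hx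
    have h3 := norm_le_norm_add_norm_sub' (v x) (v x₀)
    linarith
  have hPL : IsPicardLindelof (fun _ => v) (tmin := -ε) (tmax := ε)
      ⟨0, by constructor <;> linarith⟩ x₀ ⟨a, ha.le⟩ ⟨a / 2, by positivity⟩ ⟨L, hL0⟩ K := by
    refine IsPicardLindelof.of_time_independent hb (hK.mono hat) ?_
    simp only [sub_zero, zero_sub, neg_neg, max_self]
    have : L * ε ≤ (L + 1) * ε := by nlinarith
    have h2 : (L + 1) * ε = a / 2 := by rw [hε]; field_simp
    change L * ε ≤ a - a / 2
    linarith
  obtain ⟨α, hα, hc⟩ := hPL.exists_forall_mem_closedBall_eq_hasDerivWithinAt_continuousOn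
  exact ⟨ε, hε0, a / 2, by positivity, α, hα, hc⟩

lemma hasDerivWithinAt_Ici_of_isIntegralCurveOn {γ : ℝ → E} {w : ℝ → E → E} {a b t : ℝ}
    (h : IsIntegralCurveOn γ w (Icc a b)) (ht : t ∈ Ico a b) :
    HasDerivWithinAt γ (w t (γ t)) (Ici t) t :=
  (h t (Ico_subset_Icc_self ht)).mono_of_mem_nhdsWithin (Icc_mem_nhdsGE_of_mem ht)

lemma exists_lipschitzOnWith_image_union {Y : Type*} [PseudoMetricSpace Y] {w : Y → Y}
    (hv : LocallyLipschitz w) {f g : ℝ → Y} {a b : ℝ}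
    (hf : ContinuousOn f (Icc a b)) (hg : ContinuousOn g (Icc a b)) :
    ∃ K, LipschitzOnWith K w (f '' Icc a b ∪ g '' Icc a b) :=
  LocallyLipschitzOn.exists_lipschitzOnWith_of_compact
    ((isCompact_Icc.image_of_continuousOn hf).union (isCompact_Icc.image_of_continuousOn hg))
    hv.locallyLipschitzOn

lemma eqOn_Icc_of_isIntegralCurveOn (hv : LocallyLipschitz v) {f g : ℝ → E} {a b : ℝ}
    (hf : IsIntegralCurveOn f (fun _ => v) (Icc a b))
    (hg : IsIntegralCurveOn g (fun _ => v) (Icc a b)) (h : f a = g a) : EqOn f g (Icc a b) := by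
  obtain ⟨K, hK⟩ := exists_lipschitzOnWith_image_union hv hf.continuousOn hg.continuousOn
  exact ODE_solution_unique_of_mem_Icc_right (v := fun _ => v)
    (s := fun _ => f '' Icc a b ∪ g '' Icc a b) (fun _ _ => hK) hf.continuousOn
    (fun t ht => hasDerivWithinAt_Ici_of_isIntegralCurveOn hf ht)
    (fun t ht => Or.inl (mem_image_of_mem _ (Ico_subset_Icc_self ht))) hg.continuousOn
    (fun t ht => hasDerivWithinAt_Ici_of_isIntegralCurveOn hg ht)
    (fun t ht => Or.inr (mem_image_of_mem _ (Ico_subset_Icc_self ht))) h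

lemma eqOn_Icc_of_isIntegralCurveOn_of_mem (hv : LocallyLipschitz v) {f g : ℝ → E} {a b t₀ : ℝ}
    (ht₀ : t₀ ∈ Ioo a b) (hf : IsIntegralCurveOn f (fun _ => v) (Icc a b))
    (hg : IsIntegralCurveOn g (fun _ => v) (Icc a b)) (h : f t₀ = g t₀) :
    EqOn f g (Icc a b) := by
  obtain ⟨K, hK⟩ := exists_lipschitzOnWith_image_union hv hf.continuousOn hg.continuousOn
  exact ODE_solution_unique_of_mem_Icc (v := fun _ => v)
    (s := fun _ => f '' Icc a b ∪ g '' Icc a b) (fun _ _ => hK) ht₀ hf.continuousOn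
    (fun t ht => (hf t (Ioo_subset_Icc_self ht)).hasDerivAt (Icc_mem_nhds ht.1 ht.2))
    (fun t ht => Or.inl (mem_image_of_mem _ (Ioo_subset_Icc_self ht))) hg.continuousOn
    (fun t ht => (hg t (Ioo_subset_Icc_self ht)).hasDerivAt (Icc_mem_nhds ht.1 ht.2))
    (fun t ht => Or.inr (mem_image_of_mem _ (Ioo_subset_Icc_self ht))) h

lemma eq_of_isIntegralCurve (hv : LocallyLipschitz v) {f g : ℝ → E} {t₀ : ℝ}
    (hf : IsIntegralCurve f (fun _ => v)) (hg : IsIntegralCurve g (fun _ => v))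
    (h : f t₀ = g t₀) : f = g := by
  ext t
  have h1 : t₀ ∈ Ioo (min t t₀ - 1) (max t t₀ + 1) := by grind
  have h2 : t ∈ Icc (min t t₀ - 1) (max t t₀ + 1) := by grind
  exact eqOn_Icc_of_isIntegralCurveOn_of_mem hv h1 (hf.isIntegralCurveOn _)
    (hg.isIntegralCurveOn _) h h2

/-- Two integral curves that meet at time `b` can be concatenated there. -/
lemma isIntegralCurveOn_concat {γ₁ γ₂ : ℝ → E} {s₁ s₂ : Set ℝ} {b : ℝ} (h₁ : s₁ ⊆ Iic b)
    (h₂ : s₂ ⊆ Ici b) (hb₁ : b ∈ s₁) (hb₂ : b ∈ s₂)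
    (hγ₁ : IsIntegralCurveOn γ₁ (fun _ => v) s₁) (hγ₂ : IsIntegralCurveOn γ₂ (fun _ => v) s₂)
    (h : γ₁ b = γ₂ b) :
    IsIntegralCurveOn (fun t => if t ≤ b then γ₁ t else γ₂ t) (fun _ => v) (s₁ ∪ s₂) := by
  have e₁ : EqOn (fun t => if t ≤ b then γ₁ t else γ₂ t) γ₁ s₁ := fun t ht => if_pos (h₁ ht)
  have e₂ : EqOn (fun t => if t ≤ b then γ₁ t else γ₂ t) γ₂ s₂ := fun t ht => by
    rcases (mem_Ici.1 (h₂ ht)).eq_or_lt with rfl | hlt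
    · simpa using h
    · exact if_neg (not_le.2 hlt)
  intro t ht
  refine HasDerivWithinAt.union ?_ ?_
  · by_cases hts : t ∈ s₁
    · have := (hγ₁ t hts).congr e₁ (e₁ hts)
      rwa [← e₁ hts] at this
    · have hlt : b < t := lt_of_le_of_ne (h₂ (ht.resolve_left hts)) fun h' => hts (h' ▸ hb₁)
      exact HasFDerivWithinAt.of_notMem_closure fun hcl =>
        not_le.2 hlt (closure_minimal h₁ isClosed_Iic hcl)
  · by_cases hts : t ∈ s₂
    · have := (hγ₂ t hts).congr e₂ (e₂ hts)
      rwa [← e₂ hts] at this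
    · have hlt : t < b := lt_of_le_of_ne (h₁ (ht.resolve_right hts)) fun h' => hts (h' ▸ hb₂)
      exact HasFDerivWithinAt.of_notMem_closure fun hcl =>
        not_le.2 hlt (closure_minimal h₂ isClosed_Ici hcl)

/-- An integral curve on `[0, t]` can be prolonged by a local solution through its end point. -/
lemma exists_isIntegralCurveOn_extend {γ β : ℝ → E} {t e : ℝ} (ht : 0 ≤ t) (he : 0 ≤ e)
    (hγ : IsIntegralCurveOn γ (fun _ => v) (Icc 0 t))
    (hβ : IsIntegralCurveOn β (fun _ => v) (Icc (-e) e)) (h : β 0 = γ t) :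
    ∃ γ', γ' 0 = γ 0 ∧ IsIntegralCurveOn γ' (fun _ => v) (Icc 0 (t + e)) := by
  have hβ' : IsIntegralCurveOn (fun s => β (s - t)) (fun _ => v) (Icc t (t + e)) := by
    refine (hβ.comp_sub t).mono fun s hs => ?_
    rw [mem_vadd_set_iff_neg_vadd_mem]
    change -t + s ∈ Icc (-e) e
    exact ⟨by linarith [hs.1], by linarith [hs.2]⟩
  have := isIntegralCurveOn_concat (b := t) (fun s hs => hs.2) (fun s hs => hs.1)
    (right_mem_Icc.2 ht) (left_mem_Icc.2 (by linarith)) hγ hβ' (by simp [h])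
  rw [Icc_union_Icc_eq_Icc ht (by linarith)] at this
  exact ⟨_, if_pos ht, this⟩

/-- Grönwall bound for an integral curve of a field of linear growth. -/
lemma norm_le_of_isIntegralCurveOn {C R : ℝ} (hC : ∀ x, ‖v x‖ ≤ C * (1 + ‖x‖)) {γ : ℝ → E} {T : ℝ}
    (hR : ‖γ 0‖ ≤ R) (hγ : IsIntegralCurveOn γ (fun _ => v) (Icc 0 T)) :
    ∀ t ∈ Icc 0 T, ‖γ t‖ ≤ gronwallBound R C C t := by
  intro t ht
  have := norm_le_gronwallBound_of_norm_deriv_right_le (K := C) (ε := C)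
    hγ.continuousOn (fun t ht => hasDerivWithinAt_Ici_of_isIntegralCurveOn hγ ht) hR
    (fun t _ => (hC _).trans (by rw [mul_add, mul_one, add_comm])) t ht
  rwa [sub_zero] at this

lemma norm_sub_le_of_isIntegralCurveOn {C R : ℝ} (hC0 : 0 ≤ C)
    (hC : ∀ x, ‖v x‖ ≤ C * (1 + ‖x‖)) {γ : ℝ → E} {T : ℝ} (hR : ‖γ 0‖ ≤ R)
    (hγ : IsIntegralCurveOn γ (fun _ => v) (Icc 0 T)) {s t : ℝ}
    (hs : s ∈ Icc 0 T) (ht : t ∈ Icc 0 T) :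
    ‖γ t - γ s‖ ≤ C * (1 + gronwallBound R C C T) * ‖t - s‖ := by
  refine Convex.norm_image_sub_le_of_norm_hasDerivWithin_le (f' := fun t => v (γ t))
    (fun τ hτ => hγ τ hτ) (fun τ hτ => (hC _).trans ?_) (convex_Icc 0 T) hs ht
  gcongr
  exact (norm_le_of_isIntegralCurveOn hC hR hγ τ hτ).trans
    (gronwallBound_mono ((norm_nonneg _).trans hR) hC0 hC0 hτ.2)

lemma exists_isIntegralCurveOn_Icc [CompleteSpace E] (hv : LocallyLipschitz v) {C : ℝ}
    (hC0 : 0 ≤ C) (hC : ∀ x, ‖v x‖ ≤ C * (1 + ‖x‖)) (x : E) (T : ℝ) (hT : 0 ≤ T) :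
    ∃ γ : ℝ → E, γ 0 = x ∧ IsIntegralCurveOn γ (fun _ => v) (Icc 0 T) := by
  set s : Set ℝ := {t | ∃ γ : ℝ → E, γ 0 = x ∧ IsIntegralCurveOn γ (fun _ => v) (Icc 0 t)} with hs
  have hmono : ∀ {t t'}, t ∈ s → t' ≤ t → t' ∈ s := by
    rintro t t' ⟨γ, h0, hγ⟩ htt'
    exact ⟨γ, h0, hγ.mono (Icc_subset_Icc_right htt')⟩
  have h0s : (0 : ℝ) ∈ s := by
    refine ⟨fun _ => x, rfl, fun t ht => ?_⟩
    have : Icc (0 : ℝ) 0 = {0} := Icc_self 0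
    rw [this] at ht ⊢
    rw [mem_singleton_iff.1 ht]
    exact HasFDerivWithinAt.of_subsingleton subsingleton_singleton
  refine IsClosed.Icc_subset_of_forall_exists_gt (s := s) ?_ h0s ?_ (right_mem_Icc.2 hT)
  · -- An end time that is approached is reached: the curve is Lipschitz, so it has a limit there,
    -- and the local flow near this limit has a uniform life span.
    refine isClosed_of_closure_subset fun t ht => ?_
    have htT : t ∈ Icc 0 T := closure_minimal inter_subset_right isClosed_Icc ht
    refine ⟨?_, htT⟩
    by_contra hts
    have hlt : ∀ t' < t, t' ∈ s := fun t' ht' => by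
      obtain ⟨z, hz, hz'⟩ := mem_closure_iff.1 ht (Ioi t') isOpen_Ioi ht'
      exact hmono hz'.1 (le_of_lt hz)
    have ht0 : 0 < t := lt_of_le_of_ne htT.1 fun h => hts (h ▸ h0s)
    set τ : ℕ → ℝ := fun n => t * (1 - 1 / ((n : ℝ) + 1)) with hτ
    have hn : ∀ n : ℕ, 0 < 1 / ((n : ℝ) + 1) ∧ 1 / ((n : ℝ) + 1) ≤ 1 := fun n =>
      ⟨by positivity, by rw [div_le_one (by positivity)]; linarith [n.cast_nonneg (α := ℝ)]⟩
    have hτ1 : ∀ n, τ n < t := fun n => by simp only [hτ]; nlinarith [(hn n).1]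
    have hτ0 : ∀ n, 0 ≤ τ n := fun n => mul_nonneg ht0.le (by linarith [(hn n).2])
    have hτlim : Tendsto τ atTop (𝓝 t) := by
      have := (tendsto_one_div_add_atTop_nhds_zero_nat (𝕜 := ℝ)).const_sub 1 |>.const_mul t
      rwa [sub_zero, mul_one] at this
    choose γ hγ0 hγ using fun n => hlt (τ n) (hτ1 n)
    set M := C * (1 + gronwallBound ‖x‖ C C T) with hM
    have hM0 : 0 ≤ M := mul_nonneg hC0 (by
      have := gronwallBound_mono (norm_nonneg x) hC0 hC0 hT
      rw [gronwallBound_x0] at this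
      linarith [norm_nonneg x])
    have hkey : ∀ m n, τ m ≤ τ n → ‖γ n (τ n) - γ m (τ m)‖ ≤ M * |τ n - τ m| := by
      intro m n hmn
      have h1 : γ m (τ m) = γ n (τ m) :=
        eqOn_Icc_of_isIntegralCurveOn hv (hγ m) ((hγ n).mono (Icc_subset_Icc_right hmn))
          ((hγ0 m).trans (hγ0 n).symm) (right_mem_Icc.2 (hτ0 m))
      rw [h1]
      have h2 := norm_sub_le_of_isIntegralCurveOn hC0 hC (congrArg norm (hγ0 n)).le (hγ n)
        (s := τ m) (t := τ n) ⟨hτ0 m, hmn⟩ (right_mem_Icc.2 (hτ0 n))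
      refine h2.trans ?_
      rw [Real.norm_eq_abs]
      have h3 := gronwallBound_mono (norm_nonneg x) hC0 hC0 ((hτ1 n).le.trans htT.2)
      rw [hM]
      gcongr
    have hcs : CauchySeq fun n => γ n (τ n) := by
      rw [Metric.cauchySeq_iff']
      intro e he
      obtain ⟨N, hN⟩ := Metric.cauchySeq_iff'.1 hτlim.cauchySeq (e / (M + 1)) (by positivity)
      refine ⟨N, fun n hn => ?_⟩
      have h1 : dist (γ n (τ n)) (γ N (τ N)) ≤ M * |τ n - τ N| := by
        rcases le_total (τ N) (τ n) with h | h
        · rw [dist_eq_norm]; exact hkey _ _ h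
        · rw [dist_comm, dist_eq_norm, abs_sub_comm]; exact hkey _ _ h
      have h2 := hN n hn
      rw [Real.dist_eq, lt_div_iff₀ (by positivity)] at h2
      nlinarith [abs_nonneg (τ n - τ N)]
    obtain ⟨y, hy⟩ := cauchySeq_tendsto_of_complete hcs
    obtain ⟨ε, hε, ρ, hρ, α, hα, -⟩ := exists_local_flow hv y
    obtain ⟨n, hn1, hn2⟩ := ((hy.eventually (Metric.closedBall_mem_nhds y hρ)).and
      (hτlim.eventually (lt_mem_nhds (show t - ε < t by linarith)))).exists
    obtain ⟨γ', h1, h2⟩ := exists_isIntegralCurveOn_extend (hτ0 n) hε.le (hγ n) (hα _ hn1).2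
      (hα _ hn1).1
    exact hts (hmono ⟨γ', h1.trans (hγ0 n), h2⟩ (by linarith))
  · rintro t ⟨⟨γ, h0, hγ⟩, ht⟩ t' ht'
    obtain ⟨ε, hε, ρ, hρ, α, hα, -⟩ := exists_local_flow hv (γ t)
    have hα' := hα (γ t) (Metric.mem_closedBall_self hρ.le)
    obtain ⟨γ', h1, h2⟩ := exists_isIntegralCurveOn_extend ht.1 hε.le hγ hα'.2 hα'.1
    exact ⟨min (t + ε) t', hmono ⟨γ', h1.trans h0, h2⟩ (min_le_left _ _),
      lt_min (by linarith) ht', min_le_right _ _⟩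

lemma exists_isIntegralCurveOn_Ici [CompleteSpace E] (hv : LocallyLipschitz v) {C : ℝ}
    (hC0 : 0 ≤ C) (hC : ∀ x, ‖v x‖ ≤ C * (1 + ‖x‖)) (x : E) :
    ∃ γ : ℝ → E, γ 0 = x ∧ IsIntegralCurveOn γ (fun _ => v) (Ici 0) := by
  choose! γ h0 hγ using exists_isIntegralCurveOn_Icc hv hC0 hC x
  have heq : ∀ {T T'}, 0 ≤ T → T ≤ T' → EqOn (γ T) (γ T') (Icc 0 T) := fun {T T'} hT hTT' =>
    eqOn_Icc_of_isIntegralCurveOn hv (hγ T hT)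
      ((hγ T' (hT.trans hTT')).mono (Icc_subset_Icc_right hTT'))
      ((h0 T hT).trans (h0 T' (hT.trans hTT')).symm)
  refine ⟨fun t => γ t t, h0 0 le_rfl, fun t ht => ?_⟩
  have ht0 : (0 : ℝ) ≤ t := ht
  have h1 := hγ (t + 1) (by linarith) t ⟨ht, by linarith⟩
  have h2 : HasDerivWithinAt (γ (t + 1)) (v (γ (t + 1) t)) (Ici 0) t :=
    h1.mono_of_mem_nhdsWithin (by
      rw [← Ici_inter_Iic]
      exact inter_mem self_mem_nhdsWithin
        (mem_nhdsWithin_of_mem_nhds (Iic_mem_nhds (by linarith))))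
  have h3 : γ t t = γ (t + 1) t := heq ht0 (by linarith) (right_mem_Icc.2 ht0)
  change HasDerivWithinAt (fun t => γ t t) (v (γ t t)) (Ici 0) t
  rw [h3]
  refine h2.congr_of_eventuallyEq ?_ h3
  filter_upwards [self_mem_nhdsWithin,
    mem_nhdsWithin_of_mem_nhds (Iic_mem_nhds (show t < t + 1 by linarith))] with s hs hs'
  exact heq hs hs' (right_mem_Icc.2 hs)

lemma exists_isIntegralCurve [CompleteSpace E] (hv : LocallyLipschitz v) {C : ℝ}
    (hC0 : 0 ≤ C) (hC : ∀ x, ‖v x‖ ≤ C * (1 + ‖x‖)) (x : E) :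
    ∃ γ : ℝ → E, γ 0 = x ∧ IsIntegralCurve γ (fun _ => v) := by
  obtain ⟨γ, h0, hγ⟩ := exists_isIntegralCurveOn_Ici hv hC0 hC x
  obtain ⟨β, h0', hβ⟩ := exists_isIntegralCurveOn_Ici (v := fun x => -v x) hv.neg hC0
    (fun x => by simpa using hC x) x
  have hβ' : IsIntegralCurveOn (fun t => β (-t)) (fun _ => v) (Iic 0) := by
    have := hβ.comp_mul (-1)
    simp only [Function.comp_def, mul_neg, mul_one] at this
    intro t ht
    have h2 := this t (by simpa using ht)
    have hset : {t : ℝ | -t ∈ Ici (0 : ℝ)} = Iic 0 := by ext; simp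
    rw [hset] at h2
    simpa using h2
  have := isIntegralCurveOn_concat (b := 0) subset_rfl subset_rfl (mem_Iic.2 le_rfl)
    (mem_Ici.2 le_rfl) hβ' hγ (by simp [h0, h0'])
  rw [Iic_union_Ici, isIntegralCurveOn_univ] at this
  exact ⟨_, by simp [h0'], this⟩

/-- A locally Lipschitz vector field of linear growth on a Banach space generates a global
continuous flow. -/
theorem exists_flow [CompleteSpace E] (hv : LocallyLipschitz v) {C : ℝ}
    (hC0 : 0 ≤ C) (hC : ∀ x, ‖v x‖ ≤ C * (1 + ‖x‖)) :
    ∃ Φ : ℝ → E → E, (∀ x, Φ 0 x = x) ∧ (∀ x, IsIntegralCurve (fun t => Φ t x) (fun _ => v)) ∧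
      (∀ s t x, Φ (s + t) x = Φ s (Φ t x)) ∧ Continuous (fun p : ℝ × E => Φ p.1 p.2) := by
  choose γ h0 hγ using exists_isIntegralCurve hv hC0 hC
  have hadd : ∀ s t x, γ x (s + t) = γ (γ x t) s := fun s t x => by
    have h1 : IsIntegralCurve (fun s => γ x (s + t)) (fun _ => v) := (hγ x).comp_add t
    exact congrFun (eq_of_isIntegralCurve hv (t₀ := 0) h1 (hγ (γ x t)) (by simp [h0])) s
  refine ⟨fun t x => γ x t, h0, hγ, hadd, continuous_iff_continuousAt.2 ?_⟩
  -- Joint continuity near `(0, y)`, inherited from the local flow.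
  have hloc : ∀ y, ∃ ε > 0, ∃ ρ > 0, ∀ t ∈ Ioo (-ε) ε, ∀ x ∈ Metric.ball y ρ,
      ContinuousAt (fun p : ℝ × E => γ p.2 p.1) (t, x) := by
    intro y
    obtain ⟨ε, hε, ρ, hρ, α, hα, hc⟩ := exists_local_flow hv y
    refine ⟨ε, hε, ρ, hρ, fun t ht x hx => ?_⟩
    have h1 : ContinuousAt α (x, t) := hc.continuousAt
      (prod_mem_nhds (Filter.mem_of_superset (Metric.isOpen_ball.mem_nhds hx)
        Metric.ball_subset_closedBall) (Icc_mem_nhds ht.1 ht.2))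
    have h2 : ContinuousAt (fun p : ℝ × E => α (p.2, p.1)) (t, x) :=
      ContinuousAt.comp (f := fun p : ℝ × E => (p.2, p.1)) (x := (t, x)) h1
        (continuous_swap.continuousAt)
    refine h2.congr ?_
    filter_upwards [prod_mem_nhds (Ioo_mem_nhds ht.1 ht.2) (Metric.isOpen_ball.mem_nhds hx)]
      with p hp
    have h3 := hα p.2 (Metric.ball_subset_closedBall hp.2)
    exact eqOn_Icc_of_isIntegralCurveOn_of_mem hv (t₀ := 0) ⟨by linarith, hε⟩ h3.2
      ((hγ p.2).isIntegralCurveOn _) (h3.1.trans (h0 p.2).symm) (Ioo_subset_Icc_self hp.1)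
  have hstep : ∀ s s' x, ContinuousAt (fun p : ℝ × E => γ p.2 p.1) (s, x) →
      ContinuousAt (fun p : ℝ × E => γ p.2 p.1) (s' - s, γ x s) →
      ContinuousAt (fun p : ℝ × E => γ p.2 p.1) (s', x) := by
    intro s s' x h1 h2
    have h3 : ContinuousAt (fun p : ℝ × E => (p.1 - s, γ p.2 s)) (s', x) := by
      refine (continuous_fst.sub continuous_const).continuousAt.prodMk ?_
      exact ContinuousAt.comp (f := fun p : ℝ × E => (s, p.2)) (x := (s', x))
        (g := fun p : ℝ × E => γ p.2 p.1) h1 (by fun_prop)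
    have h4 := ContinuousAt.comp (f := fun p : ℝ × E => (p.1 - s, γ p.2 s)) (x := (s', x))
      (g := fun p : ℝ × E => γ p.2 p.1) h2 h3
    refine h4.congr (Eventually.of_forall fun p => ?_)
    change γ (γ p.2 s) (p.1 - s) = γ p.2 p.1
    rw [← hadd, sub_add_cancel]
  rintro ⟨t, x⟩
  -- The set of times at which the flow is continuous along the orbit of `x` is open and closed.
  let A : Set ℝ := {s | ContinuousAt (fun p : ℝ × E => γ p.2 p.1) (s, x)}
  have hnear : ∀ s, ∀ᶠ s' in 𝓝 s, s' ∈ A ↔ s ∈ A := by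
    intro s
    obtain ⟨ε, hε, ρ, hρ, hc⟩ := hloc (γ x s)
    filter_upwards [Ioo_mem_nhds (show s - ε < s by linarith) (show s < s + ε by linarith),
      ((hγ x).continuous.continuousAt (x := s)) (Metric.ball_mem_nhds _ hρ)] with s' hs1 hs2
    refine ⟨fun h => hstep s' s x h (hc _ ⟨by linarith [hs1.2], by linarith [hs1.1]⟩ _ hs2),
      fun h => hstep s s' x h (hc _ ⟨by linarith [hs1.1], by linarith [hs1.2]⟩ _
        (Metric.mem_ball_self hρ))⟩
  have hA : IsClopen A := by
    refine ⟨⟨isOpen_iff_mem_nhds.2 fun s hs => ?_⟩, isOpen_iff_mem_nhds.2 fun s hs => ?_⟩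
    · filter_upwards [hnear s] with s' hs' h using hs (hs'.1 h)
    · filter_upwards [hnear s] with s' hs' using hs'.2 hs
  have h0A : (0 : ℝ) ∈ A := by
    obtain ⟨ε, hε, ρ, hρ, hc⟩ := hloc x
    exact hc 0 ⟨by linarith, hε⟩ x (Metric.mem_ball_self hρ)
  exact (hA.eq_univ ⟨0, h0A⟩ ▸ mem_univ t : t ∈ A)

end Flow

/-! ### Distance neighbourhoods of a convex set and inward directions -/

lemma infDist_combo_le {Q : Set X} (hQ : Convex ℝ Q) (hne : Q.Nonempty) {a b : ℝ} (ha : 0 ≤ a)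
    (hb : 0 ≤ b) (hab : a + b = 1) (x y : X) :
    Metric.infDist (a • x + b • y) Q ≤ a * Metric.infDist x Q + b * Metric.infDist y Q := by
  refine le_of_forall_pos_le_add fun e he => ?_
  obtain ⟨p, hp, hxp⟩ := (Metric.infDist_lt_iff hne).1 (lt_add_of_pos_right (Metric.infDist x Q) he)
  obtain ⟨q, hq, hyq⟩ := (Metric.infDist_lt_iff hne).1 (lt_add_of_pos_right (Metric.infDist y Q) he)
  refine (Metric.infDist_le_dist_of_mem (hQ hp hq ha hb hab)).trans ?_
  have h1 : dist (a • x + b • y) (a • p + b • q) ≤ a * dist x p + b * dist y q := by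
    refine (dist_add_add_le _ _ _ _).trans ?_
    rw [dist_smul₀, dist_smul₀, Real.norm_of_nonneg ha, Real.norm_of_nonneg hb]
  have h2 : a * e + b * e = e := by rw [← add_mul, hab, one_mul]
  nlinarith [mul_le_mul_of_nonneg_left hxp.le ha, mul_le_mul_of_nonneg_left hyq.le hb]

lemma infDist_sub_smul_le {Q : Set X} (hQ : Convex ℝ Q) (hne : Q.Nonempty) {θ s : ℝ}
    (hθ : 0 < θ) (hs : 0 ≤ s) (hsθ : s ≤ θ) (x y : X) :
    Metric.infDist (x - s • y) Q ≤
      (1 - s / θ) * Metric.infDist x Q + s / θ * Metric.infDist (x - θ • y) Q := by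
  have h1 := infDist_combo_le hQ hne (sub_nonneg.2 ((div_le_one hθ).2 hsθ)) (div_nonneg hs hθ.le)
    (sub_add_cancel 1 (s / θ)) x (x - θ • y)
  have h2 : (1 - s / θ) • x + (s / θ) • (x - θ • y) = x - s • y := by
    rw [smul_sub, smul_smul, div_mul_cancel₀ s hθ.ne', sub_smul, one_smul]
    abel
  rwa [h2] at h1

/-- `-y` is the zero vector or points from `x` strictly into `{z | infDist z Q ≤ μ}`. Together
with `0`, these vectors form a convex set, and a flow that follows them cannot leave the
neighbourhood. -/
def PointsInward (Q : Set X) (μ : ℝ) (x y : X) : Prop :=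
  y = 0 ∨ ∃ θ : ℝ, 0 < θ ∧ Metric.infDist (x - θ • y) Q < μ

lemma PointsInward.convex {Q : Set X} (hQ : Convex ℝ Q) (hne : Q.Nonempty) {μ : ℝ} {x : X}
    (hx : Metric.infDist x Q ≤ μ) : Convex ℝ {y | PointsInward Q μ x y} := by
  have hshrink : ∀ {y : X} {θ θ' : ℝ}, 0 < θ' → θ' ≤ θ → Metric.infDist (x - θ • y) Q < μ →
      Metric.infDist (x - θ' • y) Q < μ := by
    intro y θ θ' h0 hle hlt
    have hθ : 0 < θ := h0.trans_le hle
    have h1 := infDist_sub_smul_le hQ hne hθ h0.le hle x y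
    have h2 : 0 < θ' / θ := div_pos h0 hθ
    have h3 : θ' / θ ≤ 1 := (div_le_one hθ).2 hle
    nlinarith [mul_le_mul_of_nonneg_left hx (sub_nonneg.2 h3), mul_lt_mul_of_pos_left hlt h2]
  have hscale : ∀ {z : X} {b : ℝ}, 0 ≤ b → PointsInward Q μ x z → PointsInward Q μ x (b • z) := by
    intro z b hb hz
    rcases hz with rfl | ⟨θ, hθ, hlt⟩
    · exact Or.inl (smul_zero b)
    rcases hb.eq_or_lt with rfl | hb
    · exact Or.inl (zero_smul ℝ z)
    · exact Or.inr ⟨θ / b, div_pos hθ hb, by rwa [smul_smul, div_mul_cancel₀ θ hb.ne']⟩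
  intro y hy z hz a b ha hb hab
  rcases id hy with h0 | ⟨θ, hθ, hlt⟩
  · rw [h0, smul_zero, zero_add]; exact hscale hb hz
  rcases id hz with h0 | ⟨θ', hθ', hlt'⟩
  · rw [h0, smul_zero, add_zero]; exact hscale ha hy
  refine Or.inr ⟨min θ θ', lt_min hθ hθ', ?_⟩
  have h1 := hshrink (lt_min hθ hθ') (min_le_left _ _) hlt
  have h2 := hshrink (lt_min hθ hθ') (min_le_right _ _) hlt'
  set m := min θ θ'
  have h3 : x - m • (a • y + b • z) = a • (x - m • y) + b • (x - m • z) := by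
    have : x = a • x + b • x := by rw [← add_smul, hab, one_smul]
    nth_rewrite 1 [this]
    simp only [smul_sub, smul_add, smul_comm m]
    abel
  rw [h3]
  refine (infDist_combo_le hQ hne ha hb hab _ _).trans_lt ?_
  rcases ha.eq_or_lt with rfl | ha'
  · rw [zero_add] at hab
    subst hab
    linarith
  · have h4 := mul_lt_mul_of_pos_left h1 ha'
    have h5 := mul_le_mul_of_nonneg_left h2.le hb
    have h6 : a * μ + b * μ = μ := by rw [← add_mul, hab, one_mul]
    linarith

lemma isClosed_dPlus {Y : Type*} [NormedAddCommGroup Y] (Q : Set Y) (μ : ℝ) : IsClosed (DPlus Q μ) :=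
  isClosed_le (Metric.continuous_infDist_pt Q) continuous_const

lemma infDist_neg_neg {Y : Type*} [NormedAddCommGroup Y] (x : Y) (P : Set Y) :
    Metric.infDist (-x) (-P) = Metric.infDist x P := by
  rw [← image_neg_eq_neg]
  exact Metric.infDist_image (IsometryEquiv.neg Y).isometry

lemma dMinus_eq_neg {Y : Type*} [NormedAddCommGroup Y] (P : Set Y) (μ : ℝ) : DMinus P μ = -DPlus P μ := by
  ext x
  rw [Set.mem_neg]
  change Metric.infDist x (-P) ≤ μ ↔ Metric.infDist (-x) P ≤ μ
  rw [← infDist_neg_neg (-x) P, neg_neg]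

lemma neg_mem_frontier_dMinus {Y : Type*} [NormedAddCommGroup Y] {P : Set Y} {μ : ℝ} {x : Y} :
    -x ∈ frontier (DMinus P μ) ↔ x ∈ frontier (DPlus P μ) := by
  have h := (Homeomorph.neg Y).preimage_frontier (DPlus P μ)
  have h2 : (Homeomorph.neg Y) ⁻¹' DPlus P μ = DMinus P μ := (dMinus_eq_neg P μ).symm
  rw [h2] at h
  rw [← h]
  simp

lemma neg_mem_frontier_dPlus {Y : Type*} [NormedAddCommGroup Y] {P : Set Y} {μ : ℝ} {x : Y} :
    -x ∈ frontier (DPlus P μ) ↔ x ∈ frontier (DMinus P μ) := by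
  rw [← neg_mem_frontier_dMinus, neg_neg]

lemma neg_mem_interior_dMinus {Y : Type*} [NormedAddCommGroup Y] {P : Set Y} {μ : ℝ} {x : Y} :
    -x ∈ interior (DMinus P μ) ↔ x ∈ interior (DPlus P μ) := by
  have h := (Homeomorph.neg Y).preimage_interior (DPlus P μ)
  have h2 : (Homeomorph.neg Y) ⁻¹' DPlus P μ = DMinus P μ := (dMinus_eq_neg P μ).symm
  rw [h2] at h
  rw [← h]
  simp

lemma PointsInward.neg {P : Set X} {μ : ℝ} {x y : X} (h : PointsInward P μ x y) :
    PointsInward (-P) μ (-x) (-y) := by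
  rcases h with rfl | ⟨θ, hθ, hlt⟩
  · exact Or.inl neg_zero
  · refine Or.inr ⟨θ, hθ, ?_⟩
    have : -x - θ • -y = -(x - θ • y) := by rw [smul_neg]; abel
    rwa [this, infDist_neg_neg]

/-- Flow invariance. At a point of last contact with the neighbourhood the curve would move
strictly inwards, or the field would vanish and the curve be stationary. -/
lemma mem_dPlus_of_isIntegralCurve {Q : Set X} (hQ : Convex ℝ Q) (hne : Q.Nonempty) {μ : ℝ}
    {V : X → X} (hV : LocallyLipschitz V)
    (hin : ∀ x ∈ frontier (DPlus Q μ), PointsInward Q μ x (V x)) {γ : ℝ → X}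
    (hγ : IsIntegralCurve γ (fun _ x => -V x)) (h0 : γ 0 ∈ DPlus Q μ) {t : ℝ} (ht : 0 ≤ t) :
    γ t ∈ DPlus Q μ := by
  by_contra hout
  have hcl := isClosed_dPlus Q μ
  have hcpt : IsCompact (Icc 0 t ∩ γ ⁻¹' DPlus Q μ) :=
    isCompact_Icc.inter_right (hcl.preimage hγ.continuous)
  obtain ⟨t₀, ⟨ht₀, ht₀D⟩, hmax⟩ := hcpt.exists_isGreatest ⟨0, ⟨le_rfl, ht⟩, h0⟩
  have hlt : t₀ < t := lt_of_le_of_ne ht₀.2 fun h => hout (h ▸ ht₀D)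
  have hafter : ∀ᶠ s in 𝓝[>] t₀, γ s ∉ DPlus Q μ := by
    filter_upwards [Ioc_mem_nhdsGT hlt] with s hs hsD
    exact not_le.2 hs.1 (hmax ⟨⟨ht₀.1.trans hs.1.le, hs.2⟩, hsD⟩)
  have hfr : γ t₀ ∈ frontier (DPlus Q μ) := by
    rw [frontier_eq_closure_inter_closure]
    refine ⟨subset_closure ht₀D, mem_closure_of_tendsto
      ((hγ.continuous.continuousAt (x := t₀)).tendsto.mono_left nhdsWithin_le_nhds) hafter⟩
  rcases hin _ hfr with hz | ⟨θ, hθ, hθlt⟩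
  · have hconst : IsIntegralCurve (fun _ : ℝ => γ t₀) (fun _ x => -V x) := fun s => by
      simpa [hz] using hasDerivAt_const s (γ t₀)
    have := congrFun (eq_of_isIntegralCurve (t₀ := t₀) hV.neg hγ hconst rfl) t
    rw [this] at hout
    exact hout ht₀D
  · set κ := μ - Metric.infDist (γ t₀ - θ • V (γ t₀)) Q with hκ
    have hκ0 : 0 < κ := by linarith
    have hder := (hasDerivAt_iff_isLittleO.1 (hγ t₀)).def
      (show 0 < κ / (2 * θ) by positivity)
    have hθev : ∀ᶠ s in 𝓝[>] t₀, s ∈ Ioc t₀ (t₀ + θ) := Ioc_mem_nhdsGT (by linarith)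
    obtain ⟨s, hs1, hs2, hs3⟩ :=
      (hafter.and ((hder.filter_mono nhdsWithin_le_nhds).and hθev)).exists
    refine hs1 ?_
    have hs0 : 0 < s - t₀ := by linarith [hs3.1]
    have h1 := infDist_sub_smul_le hQ hne hθ hs0.le (by linarith [hs3.2]) (γ t₀) (V (γ t₀))
    have h2 : Metric.infDist (γ s) Q ≤ Metric.infDist (γ t₀ - (s - t₀) • V (γ t₀)) Q +
        κ / (2 * θ) * (s - t₀) := by
      refine (Metric.infDist_le_infDist_add_dist
        (y := γ t₀ - (s - t₀) • V (γ t₀))).trans ?_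
      gcongr
      rw [dist_eq_norm]
      rw [Real.norm_of_nonneg hs0.le] at hs2
      simp only [smul_neg, sub_neg_eq_add] at hs2
      rwa [← sub_add]
    have h3 : Metric.infDist (γ t₀) Q ≤ μ := ht₀D
    have h4 : (s - t₀) / θ ≤ 1 := (div_le_one hθ).2 (by linarith [hs3.2])
    have h5 : 0 < (s - t₀) / θ := div_pos hs0 hθ
    have h6 : κ / (2 * θ) * (s - t₀) = κ / 2 * ((s - t₀) / θ) := by field_simp
    have h7 : Metric.infDist (γ t₀ - θ • V (γ t₀)) Q = μ - κ := by rw [hκ]; ring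
    rw [h7] at h1
    rw [h6] at h2
    change Metric.infDist (γ s) Q ≤ μ
    nlinarith [mul_le_mul_of_nonneg_left h3 (sub_nonneg.2 h4)]

/-! ### Descent along integral curves -/

/-- A locally Lipschitz function decreases along a curve at the rate at which it descends along
the velocities: its upper Dini derivative there is at most `-c`. -/
lemma le_sub_mul_of_isIntegralCurve {J : X → ℝ} (hJ : LocallyLipschitz J) {w : X → X} {c : ℝ}
    {γ : ℝ → X} (hγ : IsIntegralCurve γ (fun _ => w)) {a b : ℝ} (hab : a ≤ b)
    (hd : ∀ t ∈ Ico a b, DescendsAt J (γ t) (w (γ t)) c) :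
    J (γ b) ≤ J (γ a) - c * (b - a) := by
  have hcont : Continuous fun t => J (γ t) := hJ.continuous.comp hγ.continuous
  refine image_le_of_liminf_slope_right_le_deriv_boundary (f := fun t => J (γ t))
    (B := fun t => J (γ a) - c * (t - a)) (B' := fun _ => -c) hcont.continuousOn
    (by simp) (by fun_prop) (fun t _ => ?_) (fun t ht ρ hρ => ?_) (right_mem_Icc.2 hab)
  · have := (((hasDerivAt_id t).sub_const a).const_mul c).const_sub (J (γ a))
    simpa using this.hasDerivWithinAt
  · refine Eventually.frequently ?_
    obtain ⟨K, U, hU, hK⟩ := hJ (γ t)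
    have he : 0 < (ρ + c) / (K + 1) := div_pos (by linarith) (by positivity)
    have hder := (hasDerivAt_iff_isLittleO.1 (hγ t)).def he
    have hsub : Tendsto (fun z => z - t) (𝓝[>] t) (𝓝[>] (0 : ℝ)) := by
      refine tendsto_nhdsWithin_iff.2 ⟨?_, ?_⟩
      · have : Tendsto (fun z => z - t) (𝓝 t) (𝓝 (t - t)) :=
          (continuous_id.sub continuous_const).tendsto t
        rw [sub_self] at this
        exact this.mono_left nhdsWithin_le_nhds
      · filter_upwards [self_mem_nhdsWithin] with z hz
        exact sub_pos.2 (mem_Ioi.1 hz)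
    have hpair : Tendsto (fun z => (γ t, z - t)) (𝓝[>] t) (𝓝 (γ t) ×ˢ 𝓝[>] (0 : ℝ)) :=
      tendsto_const_nhds.prodMk hsub
    filter_upwards [hpair.eventually (hd t ht), hpair.eventually
      ((tendsto_add_smul_nhds (γ t) (w (γ t))).eventually hU),
      hder.filter_mono nhdsWithin_le_nhds, self_mem_nhdsWithin,
      ((hγ.continuous.continuousAt (x := t)).eventually hU).filter_mono nhdsWithin_le_nhds]
      with z h1 h2 h3 h4 h5
    have hz : 0 < z - t := sub_pos.2 h4
    have h6 := (abs_le.1 (hK.dist_le_mul _ h5 _ h2)).2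
    have h7 : dist (γ z) (γ t + (z - t) • w (γ t)) ≤ (ρ + c) / (K + 1) * (z - t) := by
      rw [dist_eq_norm, ← sub_sub]
      rwa [Real.norm_of_nonneg hz.le] at h3
    have h8 : (K : ℝ) * ((ρ + c) / (K + 1) * (z - t)) < (ρ + c) * (z - t) := by
      have : (ρ + c) / (K + 1) * (K + 1) = ρ + c := by field_simp
      have h9 := mul_pos he hz
      nlinarith
    rw [slope_def_field, div_lt_iff₀ hz]
    have h10 := mul_le_mul_of_nonneg_left h7 K.2
    simp only [NNReal.val_eq_coe] at h10
    linarith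

/-! ### The descending vector field -/

/-- The directions from which the vector field is selected at `x`: zero on the frozen set `F`,
with descent of `J` at unit rate on `Z` and no ascent elsewhere, of linear growth, and pointing
inward on the boundaries of both cone neighbourhoods. The flow follows `-y`. -/
structure IsAdmissible (J : X → ℝ) (P : Set X) (μ : ℝ) (F Z : Set X) (C : ℝ) (x y : X) : Prop where
  eq_zero : x ∈ F → y = 0
  descends : x ∈ Z → DescendsAt J x (-y) 1
  descends_zero : DescendsAt J x (-y) 0
  norm_le : ‖y‖ ≤ C * (1 + ‖x‖)
  inward_plus : x ∈ frontier (DPlus P μ) → PointsInward P μ x y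
  inward_minus : x ∈ frontier (DMinus P μ) → PointsInward (-P) μ x y

lemma IsAdmissible.convex (J : X → ℝ) {P : Set X} (hP : Convex ℝ P) (hne : P.Nonempty) (μ : ℝ)
    (F Z : Set X) (C : ℝ) (x : X) : Convex ℝ {y | IsAdmissible J P μ F Z C x y} := by
  intro y hy z hz a b ha hb hab
  refine ⟨fun h => ?_, fun h => ?_, ?_, ?_, fun h => ?_, fun h => ?_⟩
  · rw [hy.eq_zero h, hz.eq_zero h, smul_zero, smul_zero, add_zero]
  · exact DescendsAt.convex J x 1 (hy.descends h) (hz.descends h) ha hb hab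
  · exact DescendsAt.convex J x 0 hy.descends_zero hz.descends_zero ha hb hab
  · have := (convex_closedBall (0 : X) (C * (1 + ‖x‖)))
      (mem_closedBall_zero_iff.2 hy.norm_le) (mem_closedBall_zero_iff.2 hz.norm_le) ha hb hab
    exact mem_closedBall_zero_iff.1 this
  · exact PointsInward.convex hP hne ((isClosed_dPlus P μ).frontier_subset h)
      (hy.inward_plus h) (hz.inward_plus h) ha hb hab
  · exact PointsInward.convex hP.neg hne.neg ((isClosed_dPlus (-P) μ).frontier_subset h)
      (hy.inward_minus h) (hz.inward_minus h) ha hb hab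

lemma IsAdmissible.neg {J : X → ℝ} (heven : ∀ u, J (-u) = J u) {P : Set X} {μ : ℝ} {F Z : Set X}
    (hF : ∀ x, -x ∈ F → x ∈ F) (hZ : ∀ x, -x ∈ Z → x ∈ Z) {C : ℝ} {x y : X}
    (h : IsAdmissible J P μ F Z C x y) : IsAdmissible J P μ F Z C (-x) (-y) where
  eq_zero hx := by rw [h.eq_zero (hF x hx), neg_zero]
  descends hx := (h.descends (hZ x hx)).neg heven
  descends_zero := h.descends_zero.neg heven
  norm_le := by rw [norm_neg, norm_neg]; exact h.norm_le
  inward_plus hx := by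
    have := (h.inward_minus (neg_mem_frontier_dPlus.1 hx)).neg
    rwa [neg_neg] at this
  inward_minus hx := (h.inward_plus (neg_mem_frontier_dMinus.1 hx)).neg

lemma exists_admissible_field {J : X → ℝ} {P : Set X} (hP : Convex ℝ P)
    (hne : P.Nonempty) {μ : ℝ} {F Z : Set X} (hFc : IsClosed F) (hZc : IsClosed Z)
    (hFZ : Disjoint F Z) {C : ℝ} (hC : 0 ≤ C)
    (hZ : ∀ x ∈ Z, ∃ y, DescendsAt J x (-y) 1 ∧ ‖y‖ < C * (1 + ‖x‖) ∧
      (x ∈ frontier (DPlus P μ) → ∃ θ : ℝ, 0 < θ ∧ Metric.infDist (x - θ • y) P < μ) ∧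
      (x ∈ frontier (DMinus P μ) → ∃ θ : ℝ, 0 < θ ∧ Metric.infDist (x - θ • y) (-P) < μ))
    (hsymm : (∀ u, J (-u) = J u) → (∀ x, -x ∈ F → x ∈ F) ∧ ∀ x, -x ∈ Z → x ∈ Z) :
    ∃ V : X → X, LocallyLipschitz V ∧ (∀ x, IsAdmissible J P μ F Z C x (V x)) ∧
      ((∀ u, J (-u) = J u) → ∀ x, V (-x) = -V x) := by
  have hfront : ∀ (Q : Set X) (x y : X),
      (x ∈ frontier (DPlus Q μ) → ∃ θ : ℝ, 0 < θ ∧ Metric.infDist (x - θ • y) Q < μ) →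
      ∀ᶠ z in 𝓝 x, z ∈ frontier (DPlus Q μ) → PointsInward Q μ z y := by
    intro Q x y h
    by_cases hx : x ∈ frontier (DPlus Q μ)
    · obtain ⟨θ, hθ, hlt⟩ := h hx
      have hc : Continuous fun z => Metric.infDist (z - θ • y) Q :=
        (Metric.continuous_infDist_pt Q).comp (continuous_id.sub continuous_const)
      filter_upwards [hc.continuousAt.eventually (gt_mem_nhds hlt)] with z hz _
      exact Or.inr ⟨θ, hθ, hz⟩
    · filter_upwards [isClosed_frontier.isOpen_compl.mem_nhds hx] with z hz hz'
      exact absurd hz' hz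
  obtain ⟨V, hVL, hV⟩ := exists_locallyLipschitz_forall_mem_convex_of_local_const
    (t := fun x => {y | IsAdmissible J P μ F Z C x y}) (IsAdmissible.convex J hP hne μ F Z C) (by
      intro x
      by_cases hx : x ∈ Z
      · obtain ⟨y, hy1, hy2, hy3, hy4⟩ := hZ x hx
        have hnorm : ∀ᶠ z in 𝓝 x, ‖y‖ < C * (1 + ‖z‖) :=
          (Continuous.continuousAt (by fun_prop)).eventually (lt_mem_nhds hy2)
        refine ⟨y, ?_⟩
        filter_upwards [hy1.eventually, hnorm, hfront P x y hy3, hfront (-P) x y hy4,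
          hFc.isOpen_compl.mem_nhds (disjoint_right.1 hFZ hx)] with z h1 h2 h3 h4 h5
        exact ⟨fun h => absurd h h5, fun _ => h1, h1.mono zero_le_one, h2.le, h3, h4⟩
      · refine ⟨0, ?_⟩
        filter_upwards [hZc.isOpen_compl.mem_nhds hx] with z hz
        refine ⟨fun _ => rfl, fun h => absurd h hz, ?_, ?_, fun _ => Or.inl rfl,
          fun _ => Or.inl rfl⟩
        · rw [neg_zero]; exact descendsAt_zero J z
        · rw [norm_zero]; positivity)
  by_cases heven : ∀ u, J (-u) = J u
  · obtain ⟨hF, hZs⟩ := hsymm heven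
    refine ⟨fun x => (1 / 2 : ℝ) • V x + (1 / 2 : ℝ) • -V (-x), ?_, fun x => ?_, fun _ x => ?_⟩
    · have hhalf : LocallyLipschitz fun y : X => (1 / 2 : ℝ) • y :=
        (lipschitzWith_smul (1 / 2 : ℝ)).locallyLipschitz
      have hneg : LocallyLipschitz fun y : X => -y := LocallyLipschitz.id.neg
      exact (hhalf.comp hVL).add (hhalf.comp (hVL.comp hneg).neg)
    · have h1 := (hV (-x)).neg heven hF hZs
      rw [neg_neg] at h1
      exact IsAdmissible.convex J hP hne μ F Z C x (hV x) h1 (by norm_num) (by norm_num)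
        (by norm_num)
    · simp only [neg_neg, smul_neg, neg_add]
      abel
  · exact ⟨V, hVL, hV, fun h => absurd h heven⟩

/-! ### Consequences of the compactness condition -/

/-- On a closed set without critical points at level `r`, the compactness condition bounds
`(1 + ‖x‖) m(x)` from below near that level. -/
lemma exists_slope_lower_bound {J : X → ℝ} (hJ : LocallyLipschitz J) {r : ℝ}
    (hC : CConditionAt J univ univ r) {G : Set X} (hGc : IsClosed G)
    (hG : ∀ x ∈ G, J x = r → slope J x ≠ 0) :
    ∃ σ > 0, ∀ x ∈ G, |J x - r| ≤ σ → σ ≤ (1 + ‖x‖) * slope J x := by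
  by_contra! H
  choose x hxG hxJ hxs using fun n : ℕ => H (1 / ((n : ℝ) + 1)) (by positivity)
  have h0 := tendsto_one_div_add_atTop_nhds_zero_nat (𝕜 := ℝ)
  have hJlim : Tendsto (fun n => J (x n)) atTop (𝓝 r) := by
    rw [tendsto_iff_dist_tendsto_zero]
    exact squeeze_zero (fun _ => dist_nonneg) hxJ h0
  have hnn : ∀ n, 0 ≤ (1 + ‖x n‖) * slope J (x n) := fun n =>
    mul_nonneg (by positivity) (slope_nonneg J _)
  have hslim : Tendsto (fun n => (1 + ‖x n‖) * slope J (x n)) atTop (𝓝 0) :=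
    squeeze_zero hnn (fun n => (hxs n).le) h0
  obtain ⟨a, k, hk, ha⟩ := hC x (fun _ => mem_univ _) hJlim (by simpa only [relSlope_univ])
  refine hG a (hGc.mem_of_tendsto ha (Eventually.of_forall fun n => hxG _)) ?_ ?_
  · exact tendsto_nhds_unique ((hJ.continuous.tendsto a).comp ha)
      (hJlim.comp hk.tendsto_atTop)
  · refine slope_eq_zero_of_tendsto hJ ha ?_
    refine squeeze_zero (fun n => slope_nonneg J _) (fun n => ?_) (hslim.comp hk.tendsto_atTop)
    have h1 := slope_nonneg J (x (k n))
    have h2 := norm_nonneg (x (k n))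
    simp only [Function.comp_apply]
    nlinarith

lemma exists_norm_le_of_mem_critLevel {J : X → ℝ} {r : ℝ} (hC : CConditionAt J univ univ r) :
    ∃ R, 0 ≤ R ∧ ∀ x ∈ critLevel J r, ‖x‖ ≤ R := by
  by_contra! H
  choose x hx hxn using fun n : ℕ => H n n.cast_nonneg
  obtain ⟨a, k, hk, ha⟩ := hC x (fun _ => mem_univ _)
    (by simp only [(hx _).2]; exact tendsto_const_nhds)
    (by simp only [relSlope_univ, (hx _).1, mul_zero]; exact tendsto_const_nhds)
  have h1 : Tendsto (fun n => ‖x (k n)‖) atTop atTop :=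
    tendsto_atTop_mono (fun n => (hxn (k n)).le)
      (tendsto_natCast_atTop_atTop.comp hk.tendsto_atTop)
  exact not_tendsto_nhds_of_tendsto_atTop h1 _ ha.norm

lemma mem_interior_dPlus_of_lt {Y : Type*} [NormedAddCommGroup Y] {Q : Set Y} {μ : ℝ} {x : Y}
    (h : Metric.infDist x Q < μ) :
    x ∈ interior (DPlus Q μ) :=
  interior_maximal (fun _ hy => le_of_lt hy)
    (isOpen_lt (Metric.continuous_infDist_pt Q) continuous_const) h

/-- The set-valued map `x ↦ x - ∇J(x)` sends the boundary of the neighbourhood into a smaller one, so `0`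
cannot belong to `∇J` there. -/
lemma slope_ne_zero_of_mem_frontier {J : X → ℝ} (hJ : LocallyLipschitz J) {Q : Set X} {μ : ℝ}
    (hμ : 0 < μ) (H : ∀ x ∈ frontier (DPlus Q μ), ∀ y ∈ setGrad J x, x - y ∈ DPlus Q (μ / 2))
    {x : X} (hx : x ∈ frontier (DPlus Q μ)) : slope J x ≠ 0 := fun h0 => by
  have h1 := H x hx 0 (zero_mem_setGrad hJ h0)
  rw [sub_zero] at h1
  have h2 : Metric.infDist x Q ≤ μ / 2 := h1
  exact hx.2 (mem_interior_dPlus_of_lt (by linarith))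

/-- The rescaled gradient direction `2 y / m(x)²` descends at a rate above `1` and has norm
`2 / m(x)`. -/
lemma exists_descending_direction (hX : IsReflexiveSpace X) {J : X → ℝ} (hJ : LocallyLipschitz J)
    {P : Set X} {μ : ℝ} (hμ : 0 < μ) (H1 : CondH1 J P μ) {σ : ℝ} (hσ : 0 < σ) {x : X}
    (hx : σ ≤ (1 + ‖x‖) * slope J x) :
    ∃ y, DescendsAt J x (-y) 1 ∧ ‖y‖ < 3 / σ * (1 + ‖x‖) ∧
      (x ∈ frontier (DPlus P μ) → ∃ θ : ℝ, 0 < θ ∧ Metric.infDist (x - θ • y) P < μ) ∧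
      (x ∈ frontier (DMinus P μ) → ∃ θ : ℝ, 0 < θ ∧ Metric.infDist (x - θ • y) (-P) < μ) := by
  have hm : 0 < slope J x := by
    have h1 := norm_nonneg x
    by_contra! hle
    nlinarith [slope_nonneg J x]
  obtain ⟨y, hy, hyn, hyd⟩ := exists_mem_setGrad hX hJ hm
  set m := slope J x
  have ha : 0 < 2 / m ^ 2 := by positivity
  have hcancel : (m ^ 2 / 2) • (2 / m ^ 2) • y = y := by
    rw [smul_smul]
    have : m ^ 2 / 2 * (2 / m ^ 2) = 1 := by field_simp
    rw [this, one_smul]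
  refine ⟨(2 / m ^ 2) • y, ?_, ?_, fun h => ⟨m ^ 2 / 2, by positivity, ?_⟩,
    fun h => ⟨m ^ 2 / 2, by positivity, ?_⟩⟩
  · refine descendsAt_of_genDirDeriv_lt hJ ?_
    rw [← smul_neg, genDirDeriv_smul hJ x _ ha]
    have h1 := mul_le_mul_of_nonneg_left hyd ha.le
    have h2 : 2 / m ^ 2 * -m ^ 2 = -2 := by field_simp
    linarith
  · rw [norm_smul, Real.norm_of_nonneg ha.le, hyn]
    have h1 : 2 / m ^ 2 * m = 2 / m := by field_simp
    rw [h1, div_mul_eq_mul_div, div_lt_div_iff₀ hm hσ]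
    nlinarith
  · rw [hcancel]
    have h1 : Metric.infDist (x - y) P ≤ μ / 2 := H1.1 x h y hy
    linarith
  · rw [hcancel]
    have h1 : Metric.infDist (x - y) (-P) ≤ μ / 2 := H1.2 x h y hy
    linarith

/-! ### Symmetry of the critical set and estimates along the flow -/

lemma neg_mem_critOuter {J : X → ℝ} (hJ : LocallyLipschitz J) (heven : ∀ u, J (-u) = J u)
    {P : Set X} {μ r : ℝ} {x : X} (hx : x ∈ critOuter J P μ r) : -x ∈ critOuter J P μ r := by
  refine ⟨⟨slope_neg_eq_zero hJ heven hx.1.1, by rw [heven]; exact hx.1.2⟩, ?_⟩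
  rintro (h | h)
  · exact hx.2 (Or.inr (by rw [dMinus_eq_neg]; exact h))
  · rw [dMinus_eq_neg, Set.mem_neg, neg_neg] at h
    exact hx.2 (Or.inl h)

lemma neg_critOuter {J : X → ℝ} (hJ : LocallyLipschitz J) (heven : ∀ u, J (-u) = J u)
    {P : Set X} {μ r : ℝ} : -critOuter J P μ r = critOuter J P μ r := by
  ext x
  rw [Set.mem_neg]
  refine ⟨fun h => ?_, neg_mem_critOuter hJ heven⟩
  have := neg_mem_critOuter hJ heven h
  rwa [neg_neg] at this

lemma infEDist_neg_critOuter {J : X → ℝ} (hJ : LocallyLipschitz J) (heven : ∀ u, J (-u) = J u)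
    {P : Set X} {μ r : ℝ} (x : X) :
    Metric.infEDist (-x) (critOuter J P μ r) = Metric.infEDist x (critOuter J P μ r) := by
  conv_lhs => rw [← neg_critOuter hJ heven, ← image_neg_eq_neg]
  exact Metric.infEDist_image (IsometryEquiv.neg X).isometry

lemma mapsTo_interior_of_isHomeomorph {Y : Type*} [TopologicalSpace Y] {f : Y → Y}
    (hf : IsHomeomorph f) {D : Set Y} (hD : MapsTo f D D) :
    MapsTo f (interior D) (interior D) := fun x hx =>
  interior_maximal (by rintro _ ⟨z, hz, rfl⟩; exact hD (interior_subset hz))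
    (hf.isOpenMap _ isOpen_interior) (mem_image_of_mem f hx)

/-- An integral curve ending at `v` has stayed within a distance of `v` controlled by `‖v‖` and
the elapsed time. -/
lemma norm_start_sub_end_le {V : X → X} {C R : ℝ} (hC0 : 0 ≤ C) (hC : ∀ x, ‖V x‖ ≤ C * (1 + ‖x‖))
    {γ : ℝ → X} (hγ : IsIntegralCurve γ (fun _ x => -V x)) {s : ℝ} (hs0 : 0 ≤ s) (hs1 : s ≤ 1)
    (hR : ‖γ s‖ ≤ R) : ‖γ 0 - γ s‖ ≤ C * (1 + gronwallBound R C C 1) * s := by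
  have hrev : IsIntegralCurve (fun τ => γ (s - τ)) (fun _ => V) := fun τ => by
    have h1 := (hγ (s - τ)).scomp τ ((hasDerivAt_id τ).const_sub s)
    simpa [Function.comp_def] using h1
  have h1 := norm_sub_le_of_isIntegralCurveOn hC0 hC (γ := fun τ => γ (s - τ)) (R := R) (T := 1)
    (by simpa using hR) (hrev.isIntegralCurveOn _) (s := 0) (t := s) ⟨le_rfl, zero_le_one⟩
    ⟨hs0, hs1⟩
  simpa [abs_of_nonneg hs0] using h1

end SignChanging

/-! ### The deformation -/

open SignChanging in
theorem lemma3p4 {X : Type*} [NormedAddCommGroup X] [NormedSpace ℝ X] [CompleteSpace X]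
    (hX : SignChanging.IsReflexiveSpace X)
    (P : Set X) (hP : SignChanging.IsClosedCone P)
    (J : X → ℝ) (hJ : LocallyLipschitz J)
    (μ₀ : ℝ) (hμ₀ : 0 < μ₀) (hμ₁ : μ₀ < 1)
    (H1 : SignChanging.CondH1 J P μ₀) (H2 : SignChanging.CondH2 J P μ₀)
    (r δ : ℝ) (hδ : 0 < δ)
    (hsep : Disjoint (Metric.thickening (3 * δ) (SignChanging.critInner J P μ₀ r))
      (Metric.thickening (3 * δ) (SignChanging.critOuter J P μ₀ r))) :
    ∀ ε₀ : ℝ, 0 < ε₀ → ∃ εbar : ℝ, 0 < εbar ∧ εbar < ε₀ ∧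
      ∀ ε : ℝ, 0 < ε → ε < εbar →
      ∀ A : Set X, IsCompact A → A ⊆ SignChanging.sublevel J (r + ε) →
      ∃ η : C(unitInterval × X, X),
        (∀ (t : unitInterval) (u : X),
          (t = 0 ∨ u ∉ J ⁻¹' Set.Icc (r - ε₀) (r + ε₀) \
            Metric.thickening δ (SignChanging.critOuter J P μ₀ r)) → η (t, u) = u) ∧
        ((fun u => η (1, u)) '' (A \ Metric.thickening (3 * δ) (SignChanging.critOuter J P μ₀ r)) ⊆
          SignChanging.sublevel J (r - ε) ∪ interior (SignChanging.DPlus P μ₀) ∪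
            interior (SignChanging.DMinus P μ₀)) ∧
        (SignChanging.critOuter J P μ₀ r = ∅ →
          (fun u => η (1, u)) '' A ⊆
            SignChanging.sublevel J (r - ε) ∪ interior (SignChanging.DPlus P μ₀) ∪
              interior (SignChanging.DMinus P μ₀)) ∧
        (∀ t : unitInterval, IsHomeomorph (fun u => η (t, u))) ∧
        (∀ u : X, Antitone (fun t : unitInterval => J (η (t, u)))) ∧
        (∀ t : unitInterval,
          Set.MapsTo (fun u => η (t, u)) (SignChanging.DPlus P μ₀) (SignChanging.DPlus P μ₀) ∧
          Set.MapsTo (fun u => η (t, u)) (SignChanging.DMinus P μ₀) (SignChanging.DMinus P μ₀) ∧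
          Set.MapsTo (fun u => η (t, u))
            (SignChanging.DPlus P μ₀ ∩ SignChanging.DMinus P μ₀)
            (SignChanging.DPlus P μ₀ ∩ SignChanging.DMinus P μ₀)) ∧
        ((∀ u : X, J (-u) = J u) → ∀ (t : unitInterval) (u : X), η (t, -u) = -η (t, u)) := by
  intro ε₀ hε₀
  have hne : P.Nonempty := ⟨0, (hP.inter_neg.symm ▸ mem_singleton 0 : (0 : X) ∈ P ∩ -P).1⟩
  set K := critOuter J P μ₀ r with hK
  set G : Set X := (interior (DPlus P μ₀))ᶜ ∩ (interior (DMinus P μ₀))ᶜ ∩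
    (Metric.thickening (2 * δ) K)ᶜ with hG
  have hGc : IsClosed G := (isOpen_interior.isClosed_compl.inter isOpen_interior.isClosed_compl).inter
    Metric.isOpen_thickening.isClosed_compl
  -- A critical point at level `r` outside the open neighbourhoods is not on their boundaries
  -- either, so it belongs to `K`.
  have hGcrit : ∀ x ∈ G, J x = r → slope J x ≠ 0 := by
    rintro x ⟨⟨hx1, hx2⟩, hx3⟩ hxr hs
    refine hx3 (Metric.self_subset_thickening (by linarith) K ⟨⟨hs, hxr⟩, ?_⟩)
    rintro (h | h)
    · exact slope_ne_zero_of_mem_frontier hJ hμ₀ H1.1 ⟨subset_closure h, hx1⟩ hs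
    · exact slope_ne_zero_of_mem_frontier (Q := -P) hJ hμ₀ H1.2 ⟨subset_closure h, hx2⟩ hs
  obtain ⟨σ, hσ, hσG⟩ := exists_slope_lower_bound hJ (H2.1 r) hGc hGcrit
  obtain ⟨R, hR0, hR⟩ := exists_norm_le_of_mem_critLevel (H2.1 r)
  -- The field descends at unit rate on `Z` and vanishes on `F`.
  set ε₁ := min σ (ε₀ / 2) with hε₁
  have hε₁0 : 0 < ε₁ := lt_min hσ (by linarith)
  set Z : Set X := G ∩ {x | |J x - r| ≤ ε₁} with hZ
  set F : Set X := {x | ε₀ ≤ |J x - r|} ∪ Metric.cthickening δ K with hF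
  have habs : Continuous fun x => |J x - r| := (hJ.continuous.sub continuous_const).abs
  have hZc : IsClosed Z := hGc.inter (isClosed_le habs continuous_const)
  have hFc : IsClosed F := (isClosed_le continuous_const habs).union Metric.isClosed_cthickening
  have hFZ : Disjoint F Z := by
    rw [disjoint_left]
    rintro x (hx | hx) hxZ
    · have h1 : ε₀ ≤ |J x - r| := hx
      have h2 : |J x - r| ≤ ε₁ := hxZ.2
      have h3 : ε₁ ≤ ε₀ / 2 := min_le_right _ _
      linarith
    · exact hxZ.1.2 (Metric.cthickening_subset_thickening' (by linarith) (by linarith) K hx)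
  set C := 3 / σ with hCdef
  have hC0 : 0 ≤ C := by positivity
  obtain ⟨V, hVL, hV, hVodd⟩ := exists_admissible_field hP.convex hne hFc hZc hFZ hC0
    (fun x hx => exists_descending_direction hX hJ hμ₀ H1 hσ
      (hσG x hx.1 (le_trans hx.2 (min_le_left _ _))))
    (fun heven => by
      have hd := infEDist_neg_critOuter hJ heven (P := P) (μ := μ₀) (r := r)
      refine ⟨fun x hx => ?_, fun x hx => ?_⟩
      · rcases hx with hx | hx
        · left
          change ε₀ ≤ |J (-x) - r| at hx
          rwa [heven] at hx
        · right
          rw [Metric.mem_cthickening_iff] at hx ⊢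
          rwa [hd] at hx
      · obtain ⟨⟨⟨h1, h2⟩, h3⟩, h4⟩ := hx
        refine ⟨⟨⟨fun h => h2 (neg_mem_interior_dMinus.2 h), fun h => h1 ?_⟩, fun h => h3 ?_⟩, ?_⟩
        · have := neg_mem_interior_dMinus (P := P) (μ := μ₀) (x := -x)
          rw [neg_neg] at this
          exact this.1 h
        · rw [Metric.mem_thickening_iff_infEDist_lt] at h ⊢
          rwa [hd]
        · change |J (-x) - r| ≤ ε₁ at h4
          rwa [heven] at h4)
  have hVn : ∀ x, ‖V x‖ ≤ C * (1 + ‖x‖) := fun x => (hV x).norm_le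
  obtain ⟨Φ, hΦ0, hΦd, hΦadd, hΦc⟩ := exists_flow (v := fun x => -V x) hVL.neg hC0
    (fun x => by rw [norm_neg]; exact hVn x)
  have hΦhomeo : ∀ s, IsHomeomorph (Φ s) := fun s => by
    have hcs : ∀ s, Continuous (Φ s) := fun s => hΦc.comp (Continuous.prodMk_right s)
    exact (Homeomorph.mk ⟨Φ s, Φ (-s), fun x => by rw [← hΦadd, neg_add_cancel, hΦ0],
      fun x => by rw [← hΦadd, add_neg_cancel, hΦ0]⟩ (hcs s) (hcs (-s))).isHomeomorph
  have hplus : ∀ s, 0 ≤ s → MapsTo (Φ s) (DPlus P μ₀) (DPlus P μ₀) := fun s hs u hu =>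
    mem_dPlus_of_isIntegralCurve hP.convex hne hVL (fun x hx => (hV x).inward_plus hx) (hΦd u)
      (by rwa [hΦ0]) hs
  have hminus : ∀ s, 0 ≤ s → MapsTo (Φ s) (DMinus P μ₀) (DMinus P μ₀) := fun s hs u hu =>
    mem_dPlus_of_isIntegralCurve hP.convex.neg hne.neg hVL (fun x hx => (hV x).inward_minus hx)
      (hΦd u) (by rwa [hΦ0]) hs
  have hanti : ∀ u s t, s ≤ t → J (Φ t u) ≤ J (Φ s u) := fun u s t hst => by
    have := le_sub_mul_of_isIntegralCurve hJ (hΦd u) hst (c := 0)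
      fun τ _ => (hV (Φ τ u)).descends_zero
    linarith
  -- In time `εbar` the flow cannot cross the shell of width `δ` around the bounded set `K`.
  set M := C * (1 + gronwallBound (R + 2 * δ) C C 1) with hM
  have hM0 : 0 ≤ M := mul_nonneg hC0 (by
    have := gronwallBound_mono (show 0 ≤ R + 2 * δ by positivity) hC0 hC0 zero_le_one
    rw [gronwallBound_x0] at this
    linarith)
  set εbar := min (min ε₁ (1 / 2)) (δ / (2 * (M + 1))) with hεbar
  have hb1 : εbar ≤ ε₁ := (min_le_left _ _).trans (min_le_left _ _)
  have hb2 : εbar ≤ 1 / 2 := (min_le_left _ _).trans (min_le_right _ _)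
  have hb3 : εbar ≤ δ / (2 * (M + 1)) := min_le_right _ _
  refine ⟨εbar, by positivity, ?_, fun ε hε hεlt A _ hA => ?_⟩
  · have : ε₁ ≤ ε₀ / 2 := min_le_right _ _
    linarith
  -- An orbit from `A` that ended outside the target would have stayed in `Z` during the time
  -- `2 ε`, which suffices to descend from `r + ε` to `r - ε`.
  have hmain : ∀ u ∈ A \ Metric.thickening (3 * δ) K, Φ (2 * ε) u ∈
      sublevel J (r - ε) ∪ interior (DPlus P μ₀) ∪ interior (DMinus P μ₀) := by
    rintro u ⟨huA, huK⟩
    by_contra hout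
    rw [mem_union, mem_union, not_or, not_or] at hout
    obtain ⟨⟨hout1, hout2⟩, hout3⟩ := hout
    have hJw : r - ε < J (Φ (2 * ε) u) := not_le.1 hout1
    have hJu : J u ≤ r + ε := hA huA
    have hflow : ∀ s, Φ (2 * ε) u = Φ (2 * ε - s) (Φ s u) := fun s => by
      rw [← hΦadd, sub_add_cancel]
    have hin : ∀ s ∈ Ico 0 (2 * ε), Φ s u ∈ Z := by
      intro s hs
      have hs' : 0 ≤ 2 * ε - s := by linarith [hs.2]
      refine ⟨⟨⟨fun h => hout2 ?_, fun h => hout3 ?_⟩, fun h => huK ?_⟩, ?_⟩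
      · rw [hflow s]
        exact mapsTo_interior_of_isHomeomorph (hΦhomeo _) (hplus _ hs') h
      · rw [hflow s]
        exact mapsTo_interior_of_isHomeomorph (hΦhomeo _) (hminus _ hs') h
      · obtain ⟨z, hzK, hz⟩ := Metric.mem_thickening_iff.1 h
        have hnorm : ‖Φ s u‖ ≤ R + 2 * δ := by
          have h1 := hR z hzK.1
          rw [dist_eq_norm] at hz
          have h2 := norm_le_norm_add_norm_sub' (Φ s u) z
          linarith
        have h1 := norm_start_sub_end_le hC0 hVn (hΦd u) hs.1 (by linarith [hs.2]) hnorm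
        rw [hΦ0] at h1
        have h2 : M * s < δ := by
          have h3 : 2 * ε < δ / (M + 1) := by
            have : δ / (2 * (M + 1)) = δ / (M + 1) / 2 := by field_simp
            linarith
          rw [lt_div_iff₀ (by linarith)] at h3
          nlinarith [hs.2]
        refine Metric.mem_thickening_iff.2 ⟨z, hzK, ?_⟩
        have h4 := dist_triangle u (Φ s u) z
        rw [dist_eq_norm u (Φ s u)] at h4
        linarith
      · have h1 := hanti u s (2 * ε) hs.2.le
        have h2 := hanti u 0 s hs.1
        rw [hΦ0] at h2
        change |J (Φ s u) - r| ≤ ε₁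
        rw [abs_le]
        constructor <;> linarith
    have := le_sub_mul_of_isIntegralCurve hJ (hΦd u) (show 0 ≤ 2 * ε by linarith) (c := 1)
      fun τ hτ => (hV (Φ τ u)).descends (hin τ hτ)
    rw [hΦ0] at this
    linarith
  have hnonneg : ∀ t : unitInterval, 0 ≤ 2 * ε * (t : ℝ) := fun t =>
    mul_nonneg (by linarith) t.2.1
  obtain ⟨η, hη⟩ : ∃ η : C(unitInterval × X, X), ∀ t u, η (t, u) = Φ (2 * ε * (t : ℝ)) u :=
    ⟨⟨fun p => Φ (2 * ε * (p.1 : ℝ)) p.2, hΦc.comp ((continuous_const.mul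
      (continuous_subtype_val.comp continuous_fst)).prodMk continuous_snd)⟩, fun _ _ => rfl⟩
  refine ⟨η, ?_⟩
  simp only [hη]
  refine ⟨?_, ?_, ?_, ?_, ?_, ?_, ?_⟩
  · rintro t u (rfl | hu)
    · simp [hΦ0]
    · have hVu : V u = 0 := (hV u).eq_zero (by
        by_cases hu' : u ∈ Metric.thickening δ K
        · exact Or.inr (Metric.thickening_subset_cthickening δ K hu')
        · left
          change ε₀ ≤ |J u - r|
          by_contra! hlt
          obtain ⟨h1, h2⟩ := abs_lt.1 hlt
          exact hu ⟨⟨by linarith, by linarith⟩, hu'⟩)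
      have hconst : IsIntegralCurve (fun _ : ℝ => u) (fun _ x => -V x) := fun s => by
        simpa [hVu] using hasDerivAt_const s u
      exact congrFun (eq_of_isIntegralCurve (t₀ := 0) hVL.neg (hΦd u) hconst (hΦ0 u)) _
  · rintro _ ⟨u, hu, rfl⟩
    simpa using hmain u hu
  · rintro hKe _ ⟨u, hu, rfl⟩
    simpa using hmain u ⟨hu, by simp [hKe]⟩
  · exact fun t => hΦhomeo _
  · intro u s t hst
    exact hanti u _ _ (mul_le_mul_of_nonneg_left hst (by linarith))
  · exact fun t => ⟨hplus _ (hnonneg t), hminus _ (hnonneg t),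
      (hplus _ (hnonneg t)).inter_inter (hminus _ (hnonneg t))⟩
  · intro heven t u
    have hneg : IsIntegralCurve (fun s => -Φ s u) (fun _ x => -V x) := fun s => by
      change HasDerivAt (fun s => -Φ s u) (-V (-Φ s u)) s
      rw [hVodd heven]
      exact (hΦd u s).neg
    exact congrFun (eq_of_isIntegralCurve (t₀ := 0) hVL.neg (hΦd (-u)) hneg
      (by simp [hΦ0])) (2 * ε * (t : ℝ))
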